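/- Let $\rho,\sigma$ be quantum states on a finite-dimensional complex Hilbert space, i.e. positive semidefinite operators of unit trace, and let $0<\alpha<1$. For a Hermitian operator $X$ let $X_+$ denote its positive part, and for $\gamma\ge 1$ let $E_\gamma(\rho\|\sigma)=\mathrm{Tr}\,(\rho-\gamma\sigma)_+$. For a convex, twice differentiable function $f:(0,\infty)\to\mathbb{R}$ put $$D_f(\rho\|\sigma)=\int_1^\infty\Big(f''(\gamma)\,E_\gamma(\rho\|\sigma)+\gamma^{-3}f''(\gamma^{-1})\,E_\gamma(\sigma\|\rho)\Big)\,d\gamma ,$$ and define the Hellinger divergence $H_\alpha(\rho\|\sigma)=D_{f_\alpha}(\rho\|\sigma)$ with $f_\alpha(x)=\frac{x^\alpha-1}{\alpha-1}$, and the Rényi divergence $D_\alpha(\rho\|\sigma)=\frac{1}{\alpha-1}\log\big(1+(\alpha-1)H_\alpha(\rho\|\sigma)\big)$. Define their Petz counterparts by $$\overline H_\alpha(\rho\|\sigma)=\frac{1}{1-\alpha}\Big(1-\mathrm{Tr}\big[\rho^\alpha\sigma^{1-\alpha}\big]\Big),\qquad \overline D_\alpha(\rho\|\sigma)=\frac{1}{\alpha-1}\log\mathrm{Tr}\big[\rho^\alpha\sigma^{1-\alpha}\big].$$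 Here $\log$ is the natural logarithm with $\log 0=-\infty$, so that $D_\alpha$ and $\overline D_\alpha$ may take the value $+\infty$. Then $H_\alpha(\rho\|\sigma)\le\frac{1}{1-\alpha}$ (so $H_\alpha(\rho\|\sigma)$ is finite and the argument of the logarithm in $D_\alpha$ is nonnegative), and $$H_\alpha(\rho\|\sigma)\ \ge\ \overline H_\alpha(\rho\|\sigma),\qquad D_\alpha(\rho\|\sigma)\ \ge\ \overline D_\alpha(\rho\|\sigma).$$ -/

import Mathlib

open MeasureTheory
open scoped ENNReal ComplexOrder

/-- A quantum state on a finite-dimensional Hilbert space (in an orthonormal basis): a positive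
semidefinite complex matrix of unit trace. -/
structure IsQuantumState {n : Type*} [Fintype n] (ρ : Matrix n n ℂ) : Prop where
  posSemidef : ρ.PosSemidef
  trace_eq_one : ρ.trace = 1

/-- The positive part `X₊` of a Hermitian matrix `X`, by functional calculus. -/
noncomputable def matrixPosPart {n : Type*} [Fintype n] [DecidableEq n]
    (X : Matrix n n ℂ) : Matrix n n ℂ :=
  cfc (fun x : ℝ => max x 0) X

/-- The real power `X ^ p` (with `p > 0`, so `0 ^ p = 0`) of a positive semidefinite matrix,
by functional calculus. -/
noncomputable def matrixRpow {n : Type*} [Fintype n] [DecidableEq n]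
    (X : Matrix n n ℂ) (p : ℝ) : Matrix n n ℂ :=
  cfc (fun x : ℝ => x ^ p) X

/-- The quantum hockey-stick divergence `E_γ(ρ‖σ) = Tr (ρ - γ σ)₊`. -/
noncomputable def hockeyStick {n : Type*} [Fintype n] [DecidableEq n]
    (γ : ℝ) (ρ σ : Matrix n n ℂ) : ℝ :=
  (matrixPosPart (ρ - γ • σ)).trace.re

/-- The quantum `f`-divergence
`D_f(ρ‖σ) = ∫_1^∞ (f''(γ) E_γ(ρ‖σ) + γ⁻³ f''(γ⁻¹) E_γ(σ‖ρ)) dγ`, for `f` convex and twice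
differentiable on `(0, ∞)`. The integrand is then nonnegative, and the value lies in `[0, ∞]`. -/
noncomputable def fDivergence {n : Type*} [Fintype n] [DecidableEq n]
    (f : ℝ → ℝ) (ρ σ : Matrix n n ℂ) : ℝ≥0∞ :=
  ∫⁻ γ in Set.Ioi (1 : ℝ), ENNReal.ofReal
    (deriv (deriv f) γ * hockeyStick γ ρ σ
      + (γ ^ 3)⁻¹ * deriv (deriv f) γ⁻¹ * hockeyStick γ σ ρ)

/-- The Hellinger divergence `H_α(ρ‖σ)`: the `f`-divergence of `f_α(x) = (x ^ α - 1) / (α - 1)`. -/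
noncomputable def hellingerDivergence {n : Type*} [Fintype n] [DecidableEq n]
    (α : ℝ) (ρ σ : Matrix n n ℂ) : ℝ≥0∞ :=
  fDivergence (fun x : ℝ => (x ^ α - 1) / (α - 1)) ρ σ

/-- The Rényi divergence `D_α(ρ‖σ) = (α - 1)⁻¹ log (1 + (α - 1) H_α(ρ‖σ))`, with values in
`[-∞, ∞]`, where `log 0 = -∞` and `log ∞ = ∞`. -/
noncomputable def renyiDivergence {n : Type*} [Fintype n] [DecidableEq n]
    (α : ℝ) (ρ σ : Matrix n n ℂ) : EReal :=
  (((α - 1)⁻¹ : ℝ) : EReal) *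
    ENNReal.log (1 + ((α - 1 : ℝ) : EReal) * (hellingerDivergence α ρ σ : EReal)).toENNReal

/-- The Petz quantity `Tr[ρ ^ α σ ^ (1 - α)]` for `0 < α < 1`. -/
noncomputable def petzTrace {n : Type*} [Fintype n] [DecidableEq n]
    (α : ℝ) (ρ σ : Matrix n n ℂ) : ℝ :=
  (matrixRpow ρ α * matrixRpow σ (1 - α)).trace.re

/-- The Petz Hellinger divergence `(1 - Tr[ρ ^ α σ ^ (1 - α)]) / (1 - α)` for `0 < α < 1`. -/
noncomputable def petzHellingerDivergence {n : Type*} [Fintype n] [DecidableEq n]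
    (α : ℝ) (ρ σ : Matrix n n ℂ) : ℝ :=
  1 / (1 - α) * (1 - petzTrace α ρ σ)

/-- The Petz Rényi divergence `(α - 1)⁻¹ log Tr[ρ ^ α σ ^ (1 - α)]` for `0 < α < 1`, with values
in `[-∞, ∞]`, where `log 0 = -∞`. -/
noncomputable def petzRenyiDivergence {n : Type*} [Fintype n] [DecidableEq n]
    (α : ℝ) (ρ σ : Matrix n n ℂ) : EReal :=
  (((α - 1)⁻¹ : ℝ) : EReal) * ENNReal.log (ENNReal.ofReal (petzTrace α ρ σ))

/-! Put `J = ∫₀^∞ α γ^(α-2) (1 - E_γ(ρ‖σ)) dγ`. The identity `E_γ(σ‖ρ) = 1 - γ (1 - E_{1/γ}(ρ‖σ))`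
and the substitution `γ ↦ 1/γ` give `H_α + J = 1/(1-α)` (`hellingerDivergence_add_lintegral`). The
upper bound on `H_α` follows at once, and both comparisons reduce to `J ≤ Tr[ρ^α σ^(1-α)] / (1-α)`.

Write `N(X > c)` for the number of eigenvalues of `X` above `c`. By layer cake, `1 - E_γ = γ ∫₀^∞
(N(ρ > γu) - N(ρ - γσ > γu)) du`. Exchange the integrals and fix `u`. The first count contributes
`u^(-α) Tr ρ^α`. With `S = (σ+u)^(-1/2)`, congruence by `S` gives `N(SρS > γ) ≤ N(ρ - γσ > γu)`, so
the second contributes at least `Tr (SρS)^α`. By Araki–Lieb–Thirring this is at least `Tr (σ+u)^(-α)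
ρ^α`. What remains is the scalar integral `∫₀^∞ (u^(-α) - (s+u)^(-α)) du = s^(1-α)/(1-α)`, which
produces the Petz trace.

Araki–Lieb–Thirring is proved by growing the truncations `ρ_x = min(ρ, x)` from `0` to `ρ`. With
`f(t) = (t+ε)^α`, Klein's inequality bounds the increment of `Tr f(Sρ_xS)` below using `f'(Sρ_yS)`.
Since `Sρ_yS ≤ yS²` and `f'` is operator antitone, `f'(yS²)` may replace it. The resulting bound
matches the increment of the overlap sum up to a quadratic error, which vanishes under subdivision.
-/

/-! ### Traces in two eigenbases and Klein's inequality -/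

namespace Matrix.IsHermitian

variable {n : Type*} [Fintype n] [DecidableEq n] {A B : Matrix n n ℂ}

/-- The squared moduli of the inner products between the eigenvectors of two Hermitian matrices. -/
noncomputable def overlap (hA : A.IsHermitian) (hB : B.IsHermitian) (i j : n) : ℝ :=
  ‖(star (hA.eigenvectorUnitary : Matrix n n ℂ) * (hB.eigenvectorUnitary : Matrix n n ℂ)) i j‖ ^ 2

lemma overlap_nonneg (hA : A.IsHermitian) (hB : B.IsHermitian) (i j : n) :
    0 ≤ hA.overlap hB i j := by
  unfold overlap; positivity

lemma cfc_eq_mul (hA : A.IsHermitian) (f : ℝ → ℝ) :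
    cfc f A = (hA.eigenvectorUnitary : Matrix n n ℂ) *
      diagonal (fun i => ((f (hA.eigenvalues i) : ℝ) : ℂ)) *
        star (hA.eigenvectorUnitary : Matrix n n ℂ) := by
  rw [hA.cfc_eq, IsHermitian.cfc, Unitary.conjStarAlgAut_apply]
  rfl

lemma _root_.Matrix.continuousOn_spectrum (A : Matrix n n ℂ) (f : ℝ → ℝ) :
    ContinuousOn f (spectrum ℝ A) :=
  A.finite_real_spectrum.continuousOn f

lemma _root_.Matrix.cfc_mul_cfc (A : Matrix n n ℂ) (f g : ℝ → ℝ) :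
    cfc f A * cfc g A = cfc (fun x => f x * g x) A :=
  (cfc_mul f g A (A.continuousOn_spectrum f) (A.continuousOn_spectrum g)).symm

/-- This reduces traces of products of noncommuting functions to scalar sums. The overlaps form a
doubly stochastic matrix, so scalar inequalities in the eigenvalues can be averaged against it. -/
lemma re_trace_cfc_mul_cfc (hA : A.IsHermitian) (hB : B.IsHermitian) (f g : ℝ → ℝ) :
    (cfc f A * cfc g B).trace.re =
      ∑ i, ∑ j, hA.overlap hB i j * (f (hA.eigenvalues i) * g (hB.eigenvalues j)) := by
  set U := (hA.eigenvectorUnitary : Matrix n n ℂ) with hU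
  set V := (hB.eigenvectorUnitary : Matrix n n ℂ) with hV
  have h1 : (cfc f A * cfc g B).trace =
      (diagonal (fun i => ((f (hA.eigenvalues i) : ℝ) : ℂ)) * (star U * V) *
        (diagonal (fun i => ((g (hB.eigenvalues i) : ℝ) : ℂ)) * star (star U * V))).trace := by
    rw [cfc_eq_mul hA, cfc_eq_mul hB, star_mul, star_star, ← hU, ← hV]
    simp only [Matrix.mul_assoc]
    rw [trace_mul_comm U]
    simp only [Matrix.mul_assoc]
  rw [h1, Matrix.trace]
  simp only [diag_apply, Matrix.mul_apply (M := _ * (star U * V)), diagonal_mul, star_apply,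
    Complex.re_sum]
  refine Finset.sum_congr rfl fun i _ => Finset.sum_congr rfl fun j _ => ?_
  rw [overlap, ← hU, ← hV, ← Complex.normSq_eq_norm_sq, ← Complex.ofReal_re (Complex.normSq _ * _)]
  congr 1
  push_cast
  rw [Complex.normSq_eq_conj_mul_self]
  simp only [Complex.star_def]
  ring

lemma re_trace_cfc (hA : A.IsHermitian) (f : ℝ → ℝ) :
    (cfc f A).trace.re = ∑ i, f (hA.eigenvalues i) := by
  rw [cfc_eq_mul hA, trace_mul_comm, ← Matrix.mul_assoc, Unitary.coe_star_mul_self, Matrix.one_mul,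
    trace_diagonal, Complex.re_sum]
  rfl

lemma sum_overlap_right (hA : A.IsHermitian) (hB : B.IsHermitian) (i : n) :
    ∑ j, hA.overlap hB i j = 1 := by
  set W := star (hA.eigenvectorUnitary : Matrix n n ℂ) * (hB.eigenvectorUnitary : Matrix n n ℂ)
  have hW : W * star W = 1 := by
    simp only [W, star_mul, star_star]
    rw [Matrix.mul_assoc, ← Matrix.mul_assoc _ (star _), Unitary.mul_star_self_of_mem (SetLike.coe_mem _),
      Matrix.one_mul, Unitary.coe_star_mul_self]
  have := congrFun (congrFun hW i) i
  rw [Matrix.mul_apply, one_apply_eq] at this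
  have h2 := congrArg Complex.re this
  rw [Complex.re_sum, Complex.one_re] at h2
  rw [← h2]
  refine Finset.sum_congr rfl fun j _ => ?_
  rw [star_apply, Complex.star_def, Complex.mul_conj, Complex.ofReal_re,
    Complex.normSq_eq_norm_sq]
  rfl

lemma overlap_symm (hA : A.IsHermitian) (hB : B.IsHermitian) (i j : n) :
    hA.overlap hB i j = hB.overlap hA j i := by
  unfold overlap
  rw [← star_star (star (hA.eigenvectorUnitary : Matrix n n ℂ) * _), star_mul, star_star,
    star_apply, norm_star]

lemma sum_overlap_left (hA : A.IsHermitian) (hB : B.IsHermitian) (j : n) :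
    ∑ i, hA.overlap hB i j = 1 := by
  simp_rw [hA.overlap_symm hB]
  exact hB.sum_overlap_right hA j

/-- **Klein's inequality** for a concave function `f` with derivative `f'`. -/
lemma klein (hA : A.IsHermitian) (hB : B.IsHermitian) (f f' : ℝ → ℝ)
    (h : ∀ i j, f (hB.eigenvalues j) ≤ f (hA.eigenvalues i) +
      f' (hA.eigenvalues i) * (hB.eigenvalues j - hA.eigenvalues i)) :
    (cfc f' A * (A - B)).trace.re ≤ (cfc f A).trace.re - (cfc f B).trace.re := by
  have e1 : (cfc f' A * A).trace.re = ∑ i, ∑ j, hA.overlap hB i j *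
      (f' (hA.eigenvalues i) * hA.eigenvalues i) := by
    have h1 : cfc f' A * A = cfc (fun x => f' x * x) A := by
      rw [← cfc_mul_cfc, cfc_id' ℝ A hA.isSelfAdjoint]
    simp_rw [h1, re_trace_cfc hA, ← Finset.sum_mul, sum_overlap_right, one_mul]
  have e2 : (cfc f' A * B).trace.re = ∑ i, ∑ j, hA.overlap hB i j *
      (f' (hA.eigenvalues i) * hB.eigenvalues j) := by
    have h1 := re_trace_cfc_mul_cfc hA hB f' (fun x => x)
    rwa [cfc_id' ℝ B hB.isSelfAdjoint] at h1
  have e3 : (cfc f A).trace.re = ∑ i, ∑ j, hA.overlap hB i j * f (hA.eigenvalues i) := by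
    simp_rw [re_trace_cfc hA, ← Finset.sum_mul, sum_overlap_right, one_mul]
  have e4 : (cfc f B).trace.re = ∑ i, ∑ j, hA.overlap hB i j * f (hB.eigenvalues j) := by
    rw [Finset.sum_comm]
    simp_rw [re_trace_cfc hB, ← Finset.sum_mul, sum_overlap_left, one_mul]
  rw [Matrix.mul_sub, trace_sub, Complex.sub_re, e1, e2, e3, e4]
  simp only [← Finset.sum_sub_distrib, ← mul_sub]
  refine Finset.sum_le_sum fun i _ => Finset.sum_le_sum fun j _ =>
    mul_le_mul_of_nonneg_left ?_ (hA.overlap_nonneg hB i j)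
  linarith [h i j]

/-! ### Eigenvalue counts and inertia -/

/-- The number of eigenvalues above a threshold. -/
noncomputable def eigCount (hA : A.IsHermitian) (c : ℝ) : ℕ :=
  (Finset.univ.filter fun i => c < hA.eigenvalues i).card

lemma re_star_dotProduct_sub_smul_mulVec (hA : A.IsHermitian) (a : ℝ) (v : n → ℂ) :
    (star v ⬝ᵥ ((A - a • 1) *ᵥ v)).re = ∑ i, (hA.eigenvalues i - a) *
      ‖(star (hA.eigenvectorUnitary : Matrix n n ℂ) *ᵥ v) i‖ ^ 2 := by
  set U := (hA.eigenvectorUnitary : Matrix n n ℂ) with hU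
  have h1 : A - a • 1 = U * diagonal (fun i => ((hA.eigenvalues i - a : ℝ) : ℂ)) * star U := by
    have := cfc_eq_mul hA (fun x => x - a)
    rw [← hU] at this
    rw [← this, cfc_sub _ _ A (by fun_prop) (by fun_prop), cfc_id' ℝ A hA.isSelfAdjoint,
      cfc_const a A hA.isSelfAdjoint,
      Algebra.algebraMap_eq_smul_one]
  have h2 : star v ᵥ* U = star (star U *ᵥ v) := by
    rw [star_mulVec, star_eq_conjTranspose, conjTranspose_conjTranspose]
  rw [h1, ← mulVec_mulVec, ← mulVec_mulVec, dotProduct_mulVec, h2, dotProduct, Complex.re_sum]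
  refine Finset.sum_congr rfl fun i _ => ?_
  rw [mulVec_diagonal, Pi.star_apply, ← Complex.normSq_eq_norm_sq,
    ← Complex.ofReal_re (_ * Complex.normSq _)]
  congr 1
  push_cast
  rw [Complex.normSq_eq_conj_mul_self]
  simp only [Complex.star_def]
  ring

/-- A comparison of eigenvalue counts in the spirit of Sylvester's law of inertia. -/
lemma eigCount_le_eigCount (hA : A.IsHermitian) (hB : B.IsHermitian) (a b : ℝ)
    (T : Matrix n n ℂ)
    (h : ∀ v : n → ℂ, 0 < (star v ⬝ᵥ ((A - a • 1) *ᵥ v)).re →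
      0 < (star (T *ᵥ v) ⬝ᵥ ((B - b • 1) *ᵥ (T *ᵥ v))).re) :
    hA.eigCount a ≤ hB.eigCount b := by
  classical
  set P := Finset.univ.filter fun i => a < hA.eigenvalues i with hP
  set Q := Finset.univ.filter fun i => b < hB.eigenvalues i with hQ
  let ext : (P → ℂ) →ₗ[ℂ] (n → ℂ) :=
    { toFun := fun c i => if hi : i ∈ P then c ⟨i, hi⟩ else 0
      map_add' := by intro c d; ext i; by_cases hi : i ∈ P <;> simp [hi]
      map_smul' := by intro c d; ext i; by_cases hi : i ∈ P <;> simp [hi] }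
  -- `Φ` takes a combination `v` of eigenvectors of `A` above `a` to the coordinates of `T v` along
  -- the eigenvectors of `B` above `b`. If these vanish, the form of `B - b` is nonpositive at `T
  -- v`, which the hypothesis forbids for `v ≠ 0`. Injectivity then compares dimensions.
  let Φ : (P → ℂ) →ₗ[ℂ] (Q → ℂ) :=
    (LinearMap.funLeft ℂ ℂ (Subtype.val : Q → n)) ∘ₗ
      (Matrix.mulVecLin (star (hB.eigenvectorUnitary : Matrix n n ℂ) * T *
        (hA.eigenvectorUnitary : Matrix n n ℂ))) ∘ₗ ext
  have hΦ : Function.Injective Φ := by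
    rw [← LinearMap.ker_eq_bot, LinearMap.ker_eq_bot']
    intro c hc
    by_contra hne
    set v : n → ℂ := (hA.eigenvectorUnitary : Matrix n n ℂ) *ᵥ ext c with hv
    have hUv : star (hA.eigenvectorUnitary : Matrix n n ℂ) *ᵥ v = ext c := by
      rw [hv, mulVec_mulVec, Unitary.coe_star_mul_self, one_mulVec]
    have hpos : 0 < (star v ⬝ᵥ ((A - a • 1) *ᵥ v)).re := by
      rw [re_star_dotProduct_sub_smul_mulVec hA, hUv]
      obtain ⟨i, hi⟩ := Function.ne_iff.mp hne
      refine Finset.sum_pos' (fun k _ => ?_) ⟨i.1, Finset.mem_univ _, ?_⟩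
      · by_cases hk : k ∈ P
        · have : a < hA.eigenvalues k := by simpa [hP] using hk
          have : 0 ≤ hA.eigenvalues k - a := by linarith
          positivity
        · simp [ext, hk]
      · have : a < hA.eigenvalues i := (Finset.mem_filter.mp i.2).2
        have h0 : 0 < hA.eigenvalues i - a := by linarith
        have : ext c i.1 = c i := by simp [ext]
        rw [this]
        have : 0 < ‖c i‖ := norm_pos_iff.mpr hi
        positivity
    have h2 := h v hpos
    rw [re_star_dotProduct_sub_smul_mulVec hB] at h2
    refine absurd h2 (not_lt.mpr (Finset.sum_nonpos fun k _ => ?_))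
    by_cases hk : k ∈ Q
    · have : (star (hB.eigenvectorUnitary : Matrix n n ℂ) *ᵥ (T *ᵥ v)) k = 0 := by
        have := congrFun hc ⟨k, hk⟩
        rw [hv, mulVec_mulVec, mulVec_mulVec]
        exact this
      rw [this]; simp
    · have : hB.eigenvalues k ≤ b := by simpa [hQ] using hk
      exact mul_nonpos_of_nonpos_of_nonneg (by linarith) (by positivity)
  have := LinearMap.finrank_le_finrank_of_injective hΦ
  rw [Module.finrank_fintype_fun_eq_card, Module.finrank_fintype_fun_eq_card, Fintype.card_coe,
    Fintype.card_coe] at this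
  exact this

end Matrix.IsHermitian

/-! ### The Araki–Lieb–Thirring inequality -/

/-- A function whose increments are bounded below by a quadratic error does not decrease. -/
lemma le_of_neg_sq_le_sub {ψ : ℝ → ℝ} {a b C : ℝ} (hab : a ≤ b)
    (h : ∀ x y, a ≤ x → x ≤ y → y ≤ b → -(C * (y - x) ^ 2) ≤ ψ y - ψ x) : ψ a ≤ ψ b := by
  -- Over `N + 1` equal steps the quadratic errors add up to only `C (b - a)² / (N + 1)`.
  have key : ∀ N : ℕ, -(C * (b - a) ^ 2 / ((N : ℝ) + 1)) ≤ ψ b - ψ a := by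
    intro N
    set δ := (b - a) / ((N : ℝ) + 1) with hδ
    have hN : (0 : ℝ) < (N : ℝ) + 1 := by positivity
    have hδ0 : 0 ≤ δ := div_nonneg (by linarith) hN.le
    have hδN : δ * ((N : ℝ) + 1) = b - a := by rw [hδ]; field_simp
    have h1 : ψ b - ψ a = ∑ k ∈ Finset.range (N + 1), (ψ (a + (k + 1 : ℕ) * δ) - ψ (a + k * δ)) := by
      rw [Finset.sum_range_sub (fun k : ℕ => ψ (a + k * δ))]
      congr 2
      · push_cast; linarith
      · simp
    have h2 : -(C * (b - a) ^ 2 / ((N : ℝ) + 1)) = ∑ _k ∈ Finset.range (N + 1), -(C * δ ^ 2) := by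
      rw [Finset.sum_const, Finset.card_range, nsmul_eq_mul, ← hδN]
      push_cast
      field_simp
    rw [h1, h2]
    refine Finset.sum_le_sum fun k hk => ?_
    have hk' : (k : ℝ) + 1 ≤ (N : ℝ) + 1 := by
      exact_mod_cast Finset.mem_range.mp hk
    have h3 := h (a + k * δ) (a + (k + 1 : ℕ) * δ) (by have : 0 ≤ (k : ℝ) * δ := by positivity
                                                       linarith)
      (by push_cast; nlinarith) (by push_cast; nlinarith [mul_le_mul_of_nonneg_right hk' hδ0])
    have h4 : a + (k + 1 : ℕ) * δ - (a + k * δ) = δ := by push_cast; ring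
    rwa [h4] at h3
  have lim : Filter.Tendsto (fun N : ℕ => -(C * (b - a) ^ 2 / ((N : ℝ) + 1))) Filter.atTop
      (nhds 0) := by
    have := ((tendsto_const_div_atTop_nhds_zero_nat (C * (b - a) ^ 2)).comp
      (Filter.tendsto_add_atTop_nat 1)).neg
    simpa [Function.comp_def] using this
  exact sub_nonneg.mp (le_of_tendsto' lim key)

namespace Matrix
variable {n : Type*} [Fintype n] [DecidableEq n]

open scoped MatrixOrder Matrix.Norms.L2Operator in
/-- The function `x ↦ (x + ε) ^ (α - 1)` is operator antitone. -/
lemma PosSemidef.cfc_add_rpow_sub_one_antitone {A B : Matrix n n ℂ} (hA : A.PosSemidef)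
    (hAB : (B - A).PosSemidef) {α ε : ℝ} (hα0 : 0 < α) (hα1 : α < 1) (hε : 0 < ε) :
    (cfc (fun x : ℝ => (x + ε) ^ (α - 1)) A - cfc (fun x : ℝ => (x + ε) ^ (α - 1)) B).PosSemidef := by
  have hB : B.PosSemidef := by simpa using hA.add hAB
  have pos : ∀ X : Matrix n n ℂ, X.PosSemidef →
      IsStrictlyPositive (X + algebraMap ℝ (Matrix n n ℂ) ε) := by
    intro X hX
    rw [isStrictlyPositive_iff_posDef, Algebra.algebraMap_eq_smul_one]
    exact PosDef.posSemidef_add hX (PosDef.one.smul hε)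
  -- The function is the inverse of the power `1 - α ∈ [0, 1]` of `X + ε`: Löwner–Heinz makes the
  -- power monotone and inversion reverses the order.
  have conv : ∀ X : Matrix n n ℂ, X.PosSemidef →
      cfc (fun x : ℝ => (x + ε) ^ (α - 1)) X =
        ((X + algebraMap ℝ (Matrix n n ℂ) ε) ^ (1 - α)) ^ (-1 : ℝ) := by
    intro X hX
    have hX' : IsSelfAdjoint X := hX.isHermitian.isSelfAdjoint
    have h1 : X + algebraMap ℝ (Matrix n n ℂ) ε = cfc (fun x : ℝ => x + ε) X := by
      rw [cfc_add_const ε (fun x : ℝ => x) X (by fun_prop) hX', cfc_id' ℝ X hX']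
    rw [CFC.rpow_rpow _ _ _ (by linarith) (pos X hX), CFC.rpow_eq_cfc_real (pos X hX).nonneg, h1,
      ← cfc_comp' (fun x : ℝ => x ^ ((1 - α) * -1)) (fun x : ℝ => x + ε) X
        ((X.finite_real_spectrum.image _).continuousOn _) (by fun_prop) hX']
    congr! 3
    ring
  rw [conv A hA, conv B hB, ← le_iff]
  apply CStarAlgebra.rpow_neg_one_le_rpow_neg_one
  · apply CFC.rpow_le_rpow ⟨by linarith, by linarith⟩
    rw [le_iff]
    simpa using hAB
  · exact (pos A hA).rpow _ _

lemma IsHermitian.posSemidef_cfc {A : Matrix n n ℂ} (hA : A.IsHermitian) {f : ℝ → ℝ}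
    (hf : ∀ i, 0 ≤ f (hA.eigenvalues i)) : (cfc f A).PosSemidef := by
  rw [hA.cfc_eq_mul]
  refine PosSemidef.mul_mul_conjTranspose_same (PosSemidef.diagonal fun i => ?_) _
  simpa using hf i

lemma PosSemidef.re_trace_mul_nonneg {A B : Matrix n n ℂ} (hA : A.PosSemidef)
    (hB : B.PosSemidef) : 0 ≤ (A * B).trace.re := by
  have h := hA.isHermitian.re_trace_cfc_mul_cfc hB.isHermitian (fun x => x) (fun x => x)
  rw [cfc_id' ℝ A hA.isHermitian.isSelfAdjoint, cfc_id' ℝ B hB.isHermitian.isSelfAdjoint] at h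
  rw [h]
  exact Finset.sum_nonneg fun i _ => Finset.sum_nonneg fun j _ =>
    mul_nonneg (IsHermitian.overlap_nonneg _ _ i j)
      (mul_nonneg (hA.eigenvalues_nonneg i) (hB.eigenvalues_nonneg j))

end Matrix

/-- The graph of `t ↦ t ^ α` lies below its tangents. -/
lemma Real.rpow_le_tangent {α s t : ℝ} (hα0 : 0 < α) (hα1 : α < 1) (hs : 0 < s) (ht : 0 ≤ t) :
    t ^ α ≤ s ^ α + α * s ^ (α - 1) * (t - s) := by
  -- Weighted AM–GM for `t^α s^(1-α)`, to be multiplied by `s^(α-1)`.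
  have h := Real.geom_mean_le_arith_mean2_weighted hα0.le (by linarith : 0 ≤ 1 - α) ht hs.le
    (by ring)
  have hs1 : s ^ (α - 1) * s = s ^ α := by
    nth_rw 2 [← Real.rpow_one s]
    rw [← Real.rpow_add hs]; ring_nf
  have hs2 : s ^ (1 - α) * s ^ (α - 1) = 1 := by
    rw [← Real.rpow_add hs]; simp
  have h0 : 0 ≤ s ^ (α - 1) := Real.rpow_nonneg hs.le _
  have h3 := mul_le_mul_of_nonneg_right h h0
  rw [mul_assoc, hs2, mul_one] at h3
  linear_combination h3 + hs1 * (1 - α) + α * hs1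

/-- A Lipschitz bound on `[ε, ∞)`; the regularization `ε` exists to keep the derivative of `t ↦ t^α`
away from its singularity at `0`. -/
lemma Real.rpow_sub_one_sub_le {α ε s t : ℝ} (hα0 : 0 < α) (hα1 : α < 1) (hε : 0 < ε)
    (hs : ε ≤ s) (hst : s ≤ t) :
    s ^ (α - 1) - t ^ (α - 1) ≤ ε ^ (α - 1) / ε * (t - s) := by
  have hs0 : 0 < s := hε.trans_le hs
  have ht0 : 0 < t := hs0.trans_le hst
  have h1 : t ^ (α - 1) = s ^ (α - 1) * (s / t) ^ (1 - α) := by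
    rw [Real.div_rpow hs0.le ht0.le, ← mul_div_assoc, ← Real.rpow_add hs0, eq_div_iff (by positivity),
      ← Real.rpow_add ht0]
    simp
  have h2 : s / t ≤ (s / t) ^ (1 - α) := by
    have := Real.rpow_le_rpow_of_exponent_ge (div_pos hs0 ht0) ((div_le_one ht0).mpr hst)
      (by linarith : 1 - α ≤ 1)
    rwa [Real.rpow_one] at this
  have h3 : s ^ (α - 1) ≤ ε ^ (α - 1) := Real.rpow_le_rpow_of_nonpos hε hs (by linarith)
  have h4 : 0 < s ^ (α - 1) := Real.rpow_pos_of_pos hs0 _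
  calc s ^ (α - 1) - t ^ (α - 1) ≤ s ^ (α - 1) * (1 - s / t) := by
        rw [h1]; nlinarith
    _ = s ^ (α - 1) * ((t - s) / t) := by field_simp
    _ ≤ ε ^ (α - 1) * ((t - s) / ε) := by
        have : 0 ≤ t - s := by linarith
        gcongr
        linarith
    _ = _ := by ring

/-- The tangent at `qx + ε` gives a first-order bound. Moving its slope to `yq + ε`, where the
matrix estimate needs it, costs the quadratic term. For `p ≤ x` the truncations agree and nothing
moves. -/
lemma Real.rpow_mul_min_increment {α ε p q x y : ℝ} (hα0 : 0 < α) (hα1 : α < 1) (hε : 0 < ε)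
    (hp : 0 ≤ p) (hq : 0 ≤ q) (hx : 0 ≤ x) (hxy : x ≤ y) :
    (q * min p y + ε) ^ α - (q * min p x + ε) ^ α ≤
      q * (α * (y * q + ε) ^ (α - 1)) * (min p y - min p x) +
        α * q * (ε ^ (α - 1) / ε) * q * (y - x) ^ 2 := by
  have hE : 0 ≤ ε ^ (α - 1) / ε := by positivity
  rcases le_total p x with hpx | hpx
  · rw [min_eq_left hpx, min_eq_left (hpx.trans hxy)]
    simp only [sub_self, mul_zero, zero_add]
    positivity
  · rw [min_eq_right hpx]
    set d := min p y - x with hd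
    have hd0 : 0 ≤ d := sub_nonneg.mpr (le_min hpx hxy)
    have hd1 : d ≤ y - x := sub_le_sub_right (min_le_right _ _) _
    have h1 := Real.rpow_le_tangent hα0 hα1 (s := q * x + ε) (t := q * min p y + ε)
      (by positivity) (by have := le_min hp (hx.trans hxy); positivity)
    have h2 := Real.rpow_sub_one_sub_le hα0 hα1 hε (s := q * x + ε) (t := y * q + ε)
      (by nlinarith) (by nlinarith)
    have h3 : q * min p y + ε - (q * x + ε) = q * d := by rw [hd]; ring
    have h4 : y * q + ε - (q * x + ε) = q * (y - x) := by ring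
    rw [h3] at h1
    rw [h4] at h2
    have h5 := mul_le_mul_of_nonneg_left h2 (by positivity : 0 ≤ α * q * d)
    have h6 : α * q * d * (ε ^ (α - 1) / ε * (q * (y - x))) ≤
        α * q * (ε ^ (α - 1) / ε) * q * (y - x) ^ 2 := by
      have h7 := mul_le_mul_of_nonneg_left hd1
        (mul_nonneg (by positivity : 0 ≤ α * q * (ε ^ (α - 1) / ε) * q) (sub_nonneg.mpr hxy))
      linear_combination h7
    linear_combination h1 + h5 + h6

namespace Matrix

lemma PosSemidef.conj_isHermitian {n : Type*} [Fintype n] {A S : Matrix n n ℂ} (hA : A.PosSemidef) (hS : S.IsHermitian) :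
    (S * A * S).PosSemidef := by
  have := hA.mul_mul_conjTranspose_same S
  rwa [hS.eq] at this

variable {n : Type*} [Fintype n] [DecidableEq n]

lemma cfc_sub_cfc (A : Matrix n n ℂ) (f g : ℝ → ℝ) :
    cfc f A - cfc g A = cfc (fun x => f x - g x) A :=
  (cfc_sub f g A (A.continuousOn_spectrum f) (A.continuousOn_spectrum g)).symm

lemma IsHermitian.cfc_congr_eigenvalues {A : Matrix n n ℂ} (hA : A.IsHermitian) {f g : ℝ → ℝ}
    (h : ∀ i, f (hA.eigenvalues i) = g (hA.eigenvalues i)) : cfc f A = cfc g A := by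
  simp only [hA.cfc_eq_mul, h]

lemma IsHermitian.smul_one_eq_cfc {A : Matrix n n ℂ} (hA : A.IsHermitian) (a : ℝ) :
    a • (1 : Matrix n n ℂ) = cfc (fun _ => a) A := by
  rw [cfc_const a A hA.isSelfAdjoint, Algebra.algebraMap_eq_smul_one]

lemma PosSemidef.posSemidef_conj_cfc_min {ρ S : Matrix n n ℂ} (hρ : ρ.PosSemidef)
    (hS : S.IsHermitian) {z : ℝ} (hz : 0 ≤ z) :
    (S * cfc (fun p : ℝ => min p z) ρ * S).PosSemidef :=
  (hρ.isHermitian.posSemidef_cfc (f := fun p : ℝ => min p z)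
    fun i => le_min (hρ.eigenvalues_nonneg i) hz).conj_isHermitian hS

lemma PosSemidef.posSemidef_sub_conj_cfc_min {ρ S : Matrix n n ℂ} (hρ : ρ.PosSemidef)
    (hS : S.IsHermitian) (y : ℝ) :
    (y • (S * S) - S * cfc (fun p : ℝ => min p y) ρ * S).PosSemidef := by
  have : y • (S * S) - S * cfc (fun p : ℝ => min p y) ρ * S =
      S * (cfc (fun p : ℝ => y - min p y) ρ) * S := by
    rw [← cfc_sub_cfc, ← hρ.isHermitian.smul_one_eq_cfc]
    simp [Matrix.mul_sub, Matrix.sub_mul]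
  rw [this]
  exact (hρ.isHermitian.posSemidef_cfc (f := fun p : ℝ => y - min p y)
    fun i => sub_nonneg.mpr (min_le_right _ _)).conj_isHermitian hS

/-- `S` commutes with functions of `yS²`, so cyclicity gathers both outer factors into a single
function of `S`. -/
lemma IsHermitian.trace_cfc_smul_sq_mul_conj {S : Matrix n n ℂ} (hS : S.IsHermitian)
    (Δ : Matrix n n ℂ) (f : ℝ → ℝ) (y : ℝ) :
    (cfc f (y • (S * S)) * (S * Δ * S)).trace =
      (cfc (fun s : ℝ => s ^ 2 * f (y * s ^ 2)) S * Δ).trace := by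
  have hSS : (y • (S * S)) = cfc (fun s : ℝ => y * s ^ 2) S := by
    rw [cfc_const_mul y (fun s : ℝ => s ^ 2) S (S.continuousOn_spectrum _),
      cfc_pow (fun s : ℝ => s) 2 S (S.continuousOn_spectrum _), cfc_id' ℝ S hS.isSelfAdjoint,
      pow_two]
  have hf : cfc f (y • (S * S)) = cfc (fun s : ℝ => f (y * s ^ 2)) S := by
    rw [hSS, ← cfc_comp' f (fun s : ℝ => y * s ^ 2) S
      ((S.finite_real_spectrum.image _).continuousOn _) (S.continuousOn_spectrum _)
      hS.isSelfAdjoint]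
  have h1 : cfc (fun s : ℝ => s ^ 2 * f (y * s ^ 2)) S =
      S * cfc (fun s : ℝ => f (y * s ^ 2)) S * S := by
    have h2 : ∀ g : ℝ → ℝ, S * cfc g S * S = cfc (fun s => s * g s * s) S := fun g => by
      rw [← cfc_mul_cfc, ← cfc_mul_cfc, cfc_id' ℝ S hS.isSelfAdjoint]
    rw [h2]
    congr! 2
    ring
  rw [hf, h1, ← Matrix.mul_assoc, trace_mul_comm]
  simp only [Matrix.mul_assoc]

/-- The increment of `x ↦ Tr (S ρₓ S + ε) ^ α` along the truncations `ρₓ = min(ρ, x)`. -/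
lemma PosSemidef.trace_cfc_conj_min_increment {ρ S : Matrix n n ℂ} (hρ : ρ.PosSemidef)
    (hS : S.IsHermitian) {α ε x y : ℝ} (hα0 : 0 < α) (hα1 : α < 1) (hε : 0 < ε)
    (hx : 0 ≤ x) (hxy : x ≤ y) :
    ∑ i, ∑ j, hS.overlap hρ.isHermitian i j *
      ((hS.eigenvalues i ^ 2 * (α * (y * hS.eigenvalues i ^ 2 + ε) ^ (α - 1))) *
        (min (hρ.isHermitian.eigenvalues j) y - min (hρ.isHermitian.eigenvalues j) x)) ≤
      (cfc (fun t : ℝ => (t + ε) ^ α) (S * cfc (fun p : ℝ => min p y) ρ * S)).trace.re -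
        (cfc (fun t : ℝ => (t + ε) ^ α) (S * cfc (fun p : ℝ => min p x) ρ * S)).trace.re := by
  have hρ' := hρ.isHermitian
  have hMy := hρ.posSemidef_conj_cfc_min hS (hx.trans hxy)
  have hMx := hρ.posSemidef_conj_cfc_min hS hx
  have hanti := hMy.cfc_add_rpow_sub_one_antitone (hρ.posSemidef_sub_conj_cfc_min hS y) hα0 hα1 hε
  set Δ := cfc (fun p : ℝ => min p y - min p x) ρ with hΔ
  have hΔpos : Δ.PosSemidef := hρ'.posSemidef_cfc (f := fun p : ℝ => min p y - min p x) fun i =>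
    sub_nonneg.mpr (min_le_min_left _ hxy)
  have hk := hMy.isHermitian.klein hMx.isHermitian (fun t => (t + ε) ^ α)
    (fun t => α * (t + ε) ^ (α - 1)) (fun i j => by
      have h1 := hMy.eigenvalues_nonneg i
      have h2 := hMx.eigenvalues_nonneg j
      have := Real.rpow_le_tangent hα0 hα1 (s := hMy.isHermitian.eigenvalues i + ε)
        (t := hMx.isHermitian.eigenvalues j + ε) (by positivity) (by positivity)
      simpa using this)
  refine le_trans ?_ hk
  have hdiff : S * cfc (fun p : ℝ => min p y) ρ * S - S * cfc (fun p : ℝ => min p x) ρ * S = S * Δ * S := by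
    rw [hΔ, ← cfc_sub_cfc, Matrix.mul_sub, Matrix.sub_mul]
  have hc : ∀ X : Matrix n n ℂ, cfc (fun t : ℝ => α * (t + ε) ^ (α - 1)) X =
      α • cfc (fun t : ℝ => (t + ε) ^ (α - 1)) X := fun X =>
    cfc_const_mul α _ X (X.continuousOn_spectrum _)
  -- Operator antitonicity along `Sρ_yS ≤ yS²`, tested against the positive matrix `SΔS`.
  have hge := mul_nonneg hα0.le (hanti.re_trace_mul_nonneg (hΔpos.conj_isHermitian hS))
  rw [hdiff, hc, smul_mul_assoc, trace_smul, Complex.real_smul, Complex.re_ofReal_mul]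
  rw [Matrix.sub_mul, trace_sub, Complex.sub_re, mul_sub, sub_nonneg] at hge
  refine le_trans (le_of_eq ?_) hge
  rw [hS.trace_cfc_smul_sq_mul_conj, hΔ, hS.re_trace_cfc_mul_cfc hρ', Finset.mul_sum]
  refine Finset.sum_congr rfl fun i _ => ?_
  rw [Finset.mul_sum]
  refine Finset.sum_congr rfl fun j _ => ?_
  ring

/-- A regularized **Araki–Lieb–Thirring inequality** for `0 < α < 1`. -/
lemma PosSemidef.sum_overlap_rpow_le_add {ρ S : Matrix n n ℂ} (hρ : ρ.PosSemidef)
    (hS : S.IsHermitian) {α ε : ℝ} (hα0 : 0 < α) (hα1 : α < 1) (hε : 0 < ε) :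
    ∑ i, ∑ j, hS.overlap hρ.isHermitian i j *
      (hS.eigenvalues i ^ 2 * hρ.isHermitian.eigenvalues j + ε) ^ α ≤
      (cfc (fun t : ℝ => (t + ε) ^ α) (S * ρ * S)).trace.re := by
  have hρ' := hρ.isHermitian
  set p := hρ.isHermitian.eigenvalues with hp
  have hp0 : ∀ j, 0 ≤ p j := hρ.eigenvalues_nonneg
  set s := hS.eigenvalues with hs
  set ψ : ℝ → ℝ := fun x =>
    (cfc (fun t : ℝ => (t + ε) ^ α) (S * cfc (fun p : ℝ => min p x) ρ * S)).trace.re -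
      ∑ i, ∑ j, hS.overlap hρ.isHermitian i j * (s i ^ 2 * min (p j) x + ε) ^ α with hψ
  have hX : 0 ≤ ∑ j, p j := Finset.sum_nonneg fun j _ => hp0 j
  have hmono : ψ 0 ≤ ψ (∑ j, p j) := by
    -- `C` is the overlap-weighted sum of the quadratic coefficients in
    -- `Real.rpow_mul_min_increment`.
    refine le_of_neg_sq_le_sub (C := ∑ i, ∑ j, hS.overlap hρ.isHermitian i j *
      (α * s i ^ 2 * (ε ^ (α - 1) / ε) * s i ^ 2)) hX fun x y hx hxy _ => ?_
    have h1 := hρ.trace_cfc_conj_min_increment hS hα0 hα1 hε hx hxy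
    have h2 : ∑ i, ∑ j, hS.overlap hρ.isHermitian i j *
        ((s i ^ 2 * min (p j) y + ε) ^ α - (s i ^ 2 * min (p j) x + ε) ^ α) ≤
        ∑ i, ∑ j, hS.overlap hρ.isHermitian i j *
          (s i ^ 2 * (α * (y * s i ^ 2 + ε) ^ (α - 1)) * (min (p j) y - min (p j) x) +
            α * s i ^ 2 * (ε ^ (α - 1) / ε) * s i ^ 2 * (y - x) ^ 2) :=
      Finset.sum_le_sum fun i _ => Finset.sum_le_sum fun j _ => mul_le_mul_of_nonneg_left
        (Real.rpow_mul_min_increment hα0 hα1 hε (hp0 j) (sq_nonneg _) hx hxy)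
        (IsHermitian.overlap_nonneg _ _ i j)
    simp only [mul_add, mul_sub, Finset.sum_add_distrib, Finset.sum_sub_distrib] at h1 h2
    simp only [hψ, Finset.sum_mul]
    simp only [← mul_assoc] at h1 h2 ⊢
    linarith
  -- At `x = 0` both terms of `ψ` equal `ε^α` times the dimension.
  have h0 : ψ 0 = 0 := by
    have h1 : cfc (fun p : ℝ => min p 0) ρ = 0 := by
      rw [hρ'.cfc_eq_mul]
      have : (fun i => ((min (hρ'.eigenvalues i) 0 : ℝ) : ℂ)) = fun _ => 0 := by
        funext i; rw [min_eq_right (hρ.eigenvalues_nonneg i)]; simp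
      rw [this]; simp
    have h2 : ∀ j, min (p j) 0 = 0 := fun j => min_eq_right (hp0 j)
    simp only [hψ, h1, h2, mul_zero, zero_mul, zero_add, ← Finset.sum_mul,
      IsHermitian.sum_overlap_right]
    rw [cfc_apply_zero]
    simp [Algebra.algebraMap_eq_smul_one, trace_smul]
    ring
  -- The sum of the eigenvalues dominates each of them, so truncation at that level leaves `ρ`
  -- unchanged.
  have h2 : ∀ j, min (p j) (∑ j, p j) = p j := fun j =>
    min_eq_left (Finset.single_le_sum (fun j _ => hp0 j) (Finset.mem_univ j))
  have h1 : cfc (fun x : ℝ => min x (∑ j, p j)) ρ = ρ := by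
    rw [hρ'.cfc_congr_eigenvalues (g := fun x => x) h2, cfc_id' ℝ ρ hρ'.isSelfAdjoint]
  rw [h0] at hmono
  simp only [hψ, h1, h2, sub_nonneg] at hmono
  exact hmono

/-- The **Araki–Lieb–Thirring inequality** `Tr ρ ^ α (S²) ^ α ≤ Tr (S ρ S) ^ α`, `0 < α < 1`. -/
lemma PosSemidef.sum_overlap_rpow_le {ρ S : Matrix n n ℂ} (hρ : ρ.PosSemidef)
    (hS : S.IsHermitian) {α : ℝ} (hα0 : 0 < α) (hα1 : α < 1) :
    ∑ i, ∑ j, hS.overlap hρ.isHermitian i j *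
      (hS.eigenvalues i ^ 2 * hρ.isHermitian.eigenvalues j) ^ α ≤
      (cfc (fun t : ℝ => t ^ α) (S * ρ * S)).trace.re := by
  have hM := (hρ.conj_isHermitian hS)
  rw [hM.isHermitian.re_trace_cfc]
  have l1 : Filter.Tendsto (fun ε : ℝ => ∑ i, ∑ j, hS.overlap hρ.isHermitian i j *
      (hS.eigenvalues i ^ 2 * hρ.isHermitian.eigenvalues j + ε) ^ α) (nhdsWithin 0 (Set.Ioi 0))
      (nhds (∑ i, ∑ j, hS.overlap hρ.isHermitian i j *
        (hS.eigenvalues i ^ 2 * hρ.isHermitian.eigenvalues j + 0) ^ α)) := by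
    refine Continuous.tendsto' ?_ _ _ rfl |>.mono_left nhdsWithin_le_nhds
    have := hα0.le
    fun_prop (disch := assumption)
  have l2 : Filter.Tendsto (fun ε : ℝ => ∑ i, (hM.isHermitian.eigenvalues i + ε) ^ α)
      (nhdsWithin 0 (Set.Ioi 0)) (nhds (∑ i, (hM.isHermitian.eigenvalues i + 0) ^ α)) := by
    refine Continuous.tendsto' ?_ _ _ rfl |>.mono_left nhdsWithin_le_nhds
    have := hα0.le
    fun_prop (disch := assumption)
  simp only [add_zero] at l1 l2
  refine le_of_tendsto_of_tendsto l1 l2 ?_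
  filter_upwards [self_mem_nhdsWithin] with ε hε
  have := hρ.sum_overlap_rpow_le_add hS hα0 hα1 hε
  rwa [hM.isHermitian.re_trace_cfc] at this

end Matrix

/-! ### Scalar integrals -/

lemma lintegral_Ioi_ite_mul_lt {γ : ℝ} (hγ : 0 < γ) (l : ℝ) :
    ∫⁻ u in Set.Ioi (0 : ℝ), (if γ * u < l then 1 else 0 : ℝ≥0∞) = ENNReal.ofReal (max l 0 / γ) := by
  have h1 : (fun u : ℝ => (if γ * u < l then 1 else 0 : ℝ≥0∞)) =
      (Set.Iio (l / γ)).indicator fun _ => 1 := by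
    funext u
    simp only [Set.indicator_apply, Set.mem_Iio, lt_div_iff₀' hγ]
  rw [h1, lintegral_indicator_const measurableSet_Iio, one_mul,
    Measure.restrict_apply measurableSet_Iio, Set.inter_comm, Set.Ioi_inter_Iio, Real.volume_Ioo,
    sub_zero]
  rcases le_total l 0 with h | h
  · rw [max_eq_right h, zero_div, ENNReal.ofReal_zero,
      ENNReal.ofReal_of_nonpos (div_nonpos_of_nonpos_of_nonneg h hγ.le)]
  · rw [max_eq_left h]

lemma lintegral_Ioi_rpow_mul_ite_lt {α x : ℝ} (hα0 : 0 < α) (hx : 0 ≤ x) :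
    ∫⁻ γ in Set.Ioi (0 : ℝ), ENNReal.ofReal (α * γ ^ (α - 1)) * (if γ < x then 1 else 0) =
      ENNReal.ofReal (x ^ α) := by
  have h1 : (fun γ : ℝ => ENNReal.ofReal (α * γ ^ (α - 1)) * (if γ < x then 1 else 0)) =
      (Set.Iio x).indicator fun γ => ENNReal.ofReal (α * γ ^ (α - 1)) := by
    funext γ
    simp [Set.indicator_apply, Set.mem_Iio]
  rw [h1, setLIntegral_indicator measurableSet_Iio, Set.inter_comm, Set.Ioi_inter_Iio,
    Measure.restrict_congr_set Ioo_ae_eq_Ioc]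
  have hint : IntervalIntegrable (fun γ : ℝ => α * γ ^ (α - 1)) volume 0 x :=
    (intervalIntegral.intervalIntegrable_rpow' (by linarith)).const_mul α
  rw [← ofReal_integral_eq_lintegral_ofReal
    ((intervalIntegrable_iff_integrableOn_Ioc_of_le hx).mp hint)]
  · rw [← intervalIntegral.integral_of_le hx, intervalIntegral.integral_const_mul,
      integral_rpow (Or.inl (by linarith))]
    congr 1
    rw [sub_add_cancel, Real.zero_rpow hα0.ne', sub_zero]
    field_simp
  · filter_upwards [self_mem_ae_restrict measurableSet_Ioc] with γ hγ
    have := hγ.1.le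
    show 0 ≤ α * γ ^ (α - 1)
    positivity

lemma Real.tendsto_rpow_sub_rpow_atTop {β s : ℝ} (hβ0 : 0 < β) (hβ1 : β < 1) (hs : 0 ≤ s) :
    Filter.Tendsto (fun u : ℝ => u ^ β - (s + u) ^ β) Filter.atTop (nhds 0) := by
  have l : Filter.Tendsto (fun u : ℝ => -(β * s) * u ^ (β - 1)) Filter.atTop (nhds 0) := by
    have := (tendsto_rpow_neg_atTop (by linarith : 0 < 1 - β)).const_mul (-(β * s))
    simpa using this
  refine tendsto_of_tendsto_of_tendsto_of_le_of_le' l tendsto_const_nhds ?_ ?_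
  · filter_upwards [Filter.eventually_gt_atTop 0] with u hu
    have := Real.rpow_le_tangent hβ0 hβ1 hu (add_nonneg hs hu.le)
    rw [add_sub_cancel_right] at this
    linear_combination this
  · filter_upwards [Filter.eventually_gt_atTop 0] with u hu
    exact sub_nonpos.mpr (Real.rpow_le_rpow hu.le (by linarith) hβ0.le)

/-- Neither power is integrable at infinity by itself. The antiderivative `g` of the difference
tends to `0` there, so the integral is `-g 0`. -/
lemma lintegral_Ioi_rpow_neg_sub {α s : ℝ} (hα0 : 0 < α) (hα1 : α < 1) (hs : 0 ≤ s) :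
    ∫⁻ u in Set.Ioi (0 : ℝ), ENNReal.ofReal (u ^ (-α) - (s + u) ^ (-α)) =
      ENNReal.ofReal (s ^ (1 - α) / (1 - α)) := by
  have hα : 0 < 1 - α := by linarith
  set g : ℝ → ℝ := fun u => (u ^ (1 - α) - (s + u) ^ (1 - α)) / (1 - α) with hg
  have hcont : ContinuousWithinAt g (Set.Ici 0) 0 := by
    apply Continuous.continuousWithinAt
    have := hα.le
    fun_prop (disch := assumption)
  have hderiv : ∀ u ∈ Set.Ioi (0 : ℝ), HasDerivAt g (u ^ (-α) - (s + u) ^ (-α)) u := by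
    intro u hu
    have hu' : (0 : ℝ) < u := hu
    have h1 := Real.hasDerivAt_rpow_const (p := 1 - α) (Or.inl hu'.ne')
    have h2 := ((hasDerivAt_id u).const_add s).rpow_const (p := 1 - α)
      (Or.inl (add_pos_of_nonneg_of_pos hs hu').ne')
    refine ((h1.sub h2).div_const (1 - α)).congr_deriv ?_
    rw [show 1 - α - 1 = -α by ring]
    simp only [id]
    field_simp
  have hpos : ∀ u ∈ Set.Ioi (0 : ℝ), 0 ≤ u ^ (-α) - (s + u) ^ (-α) := fun u hu =>
    sub_nonneg.mpr (Real.rpow_le_rpow_of_nonpos hu (by linarith) (by linarith))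
  have hlim : Filter.Tendsto g Filter.atTop (nhds 0) := by
    simpa using (Real.tendsto_rpow_sub_rpow_atTop hα (by linarith) hs).div_const (1 - α)
  have hI := integrableOn_Ioi_deriv_of_nonneg hcont hderiv hpos hlim
  rw [← ofReal_integral_eq_lintegral_ofReal hI, integral_Ioi_of_hasDerivAt_of_nonneg hcont hderiv
    hpos hlim]
  · congr 1
    simp only [hg, add_zero, Real.zero_rpow hα.ne']
    ring
  · filter_upwards [self_mem_ae_restrict measurableSet_Ioi] with u hu
    exact hpos u hu

/-! ### Measurability and layer-cake integrals of eigenvalue counts -/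

namespace Matrix.IsHermitian
variable {n : Type*} [Fintype n] [DecidableEq n] {A B : Matrix n n ℂ}

lemma eigCount_eq_sum (hA : A.IsHermitian) (c : ℝ) :
    (hA.eigCount c : ℝ≥0∞) = ∑ i, if c < hA.eigenvalues i then 1 else 0 := by
  rw [eigCount, Finset.card_filter]
  push_cast
  rfl

lemma eigCount_antitone (hA : A.IsHermitian) : Antitone hA.eigCount := fun _ _ h =>
  Finset.card_le_card fun i hi => Finset.mem_filter.mpr
    ⟨Finset.mem_univ i, h.trans_lt (Finset.mem_filter.mp hi).2⟩

lemma eigCount_le_of_posSemidef_sub (hA : A.IsHermitian) (hB : B.IsHermitian)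
    (h : (B - A).PosSemidef) (c : ℝ) : hA.eigCount c ≤ hB.eigCount c := by
  refine hA.eigCount_le_eigCount hB c c 1 fun v hv => ?_
  have h1 := h.re_dotProduct_nonneg v
  have h2 : B - c • (1 : Matrix n n ℂ) = (A - c • 1) + (B - A) := by abel
  rw [one_mulVec, h2, add_mulVec, dotProduct_add, Complex.add_re]
  exact add_pos_of_pos_of_nonneg hv h1

/-- Right-continuity of a step function with finitely many jumps; rational thresholds then suffice
for joint measurability. -/
lemma exists_rat_eigCount_eq (hA : A.IsHermitian) (c : ℝ) :
    ∃ q : ℚ, c < q ∧ hA.eigCount q = hA.eigCount c := by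
  have h : ∀ᶠ x in nhdsWithin c (Set.Ioi c), ∀ i, c < hA.eigenvalues i → x < hA.eigenvalues i := by
    rw [Filter.eventually_all]
    intro i
    by_cases hi : c < hA.eigenvalues i
    · filter_upwards [Ioo_mem_nhdsGT hi] with x hx _ using hx.2
    · exact Filter.Eventually.of_forall fun x h => absurd h hi
  obtain ⟨b, hb, hsub⟩ := mem_nhdsGT_iff_exists_Ioo_subset.mp h
  obtain ⟨q, hq1, hq2⟩ := exists_rat_btwn (show c < b from hb)
  refine ⟨q, hq1, le_antisymm (hA.eigCount_antitone hq1.le) (Finset.card_le_card fun i hi => ?_)⟩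
  exact Finset.mem_filter.mpr ⟨Finset.mem_univ i, hsub ⟨hq1, hq2⟩ i (Finset.mem_filter.mp hi).2⟩

lemma measurable_eigCount (hA : A.IsHermitian) : Measurable hA.eigCount :=
  hA.eigCount_antitone.measurable

lemma measurable_eigCount_sub_smul (hσ : B.PosSemidef)
    (h : ∀ γ : ℝ, (A - γ • B).IsHermitian) :
    Measurable fun p : ℝ × ℝ => (h p.1).eigCount p.2 := by
  have hanti : ∀ c, Antitone fun γ => (h γ).eigCount c := fun c γ γ' hγ => by
    refine (h γ').eigCount_le_of_posSemidef_sub (h γ) ?_ c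
    have : A - γ • B - (A - γ' • B) = (γ' - γ) • B := by rw [sub_smul]; abel
    rw [this]
    exact hσ.smul (sub_nonneg.mpr hγ)
  refine measurable_of_Ici fun k => ?_
  -- The count decreases in each variable and is right-continuous in the threshold, so its
  -- superlevel sets are countable unions of measurable rectangles.
  have : (fun p : ℝ × ℝ => (h p.1).eigCount p.2) ⁻¹' Set.Ici k =
      ⋃ q : ℚ, {γ | k ≤ (h γ).eigCount q} ×ˢ Set.Iio (q : ℝ) := by
    ext ⟨γ, c⟩
    simp only [Set.mem_preimage, Set.mem_Ici, Set.mem_iUnion, Set.mem_prod, Set.mem_ofPred_eq,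
      Set.mem_Iio]
    constructor
    · intro hk
      obtain ⟨q, hq, hqe⟩ := (h γ).exists_rat_eigCount_eq c
      exact ⟨q, hqe ▸ hk, hq⟩
    · rintro ⟨q, hk, hq⟩
      exact hk.trans ((h γ).eigCount_antitone hq.le)
  rw [this]
  exact MeasurableSet.iUnion fun q =>
    (measurableSet_le measurable_const (hanti q).measurable).prod measurableSet_Iio

lemma lintegral_eigCount_mul (hA : A.IsHermitian) {γ : ℝ} (hγ : 0 < γ) :
    ∫⁻ u in Set.Ioi (0 : ℝ), (hA.eigCount (γ * u) : ℝ≥0∞) =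
      ENNReal.ofReal ((matrixPosPart A).trace.re / γ) := by
  simp_rw [eigCount_eq_sum]
  rw [lintegral_finsetSum]
  · simp_rw [lintegral_Ioi_ite_mul_lt hγ]
    rw [matrixPosPart, hA.re_trace_cfc, Finset.sum_div, ENNReal.ofReal_sum_of_nonneg]
    intro i _
    exact div_nonneg (le_max_right _ _) hγ.le
  · intro i _
    exact Measurable.ite (measurableSet_lt (by fun_prop) measurable_const) measurable_const
      measurable_const

lemma lintegral_rpow_mul_eigCount (hA : A.PosSemidef) {α : ℝ} (hα0 : 0 < α) {u : ℝ} (hu : 0 < u) :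
    ∫⁻ γ in Set.Ioi (0 : ℝ), ENNReal.ofReal (α * γ ^ (α - 1)) *
      (hA.isHermitian.eigCount (γ * u) : ℝ≥0∞) =
      ENNReal.ofReal (u ^ (-α) * (cfc (fun x : ℝ => x ^ α) A).trace.re) := by
  simp_rw [eigCount_eq_sum, Finset.mul_sum]
  rw [lintegral_finsetSum]
  · rw [hA.isHermitian.re_trace_cfc, Finset.mul_sum, ENNReal.ofReal_sum_of_nonneg]
    · refine Finset.sum_congr rfl fun i _ => ?_
      simp_rw [← lt_div_iff₀ hu]
      rw [lintegral_Ioi_rpow_mul_ite_lt hα0 (div_nonneg (hA.eigenvalues_nonneg i) hu.le),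
        Real.div_rpow (hA.eigenvalues_nonneg i) hu.le, Real.rpow_neg hu.le]
      congr 1
      ring
    · intro i _
      have := hA.eigenvalues_nonneg i
      positivity
  · intro i _
    exact Measurable.mul (by fun_prop) (Measurable.ite
      (measurableSet_lt (by fun_prop) measurable_const) measurable_const measurable_const)

end Matrix.IsHermitian

/-! ### Congruence by the inverse square root of `σ + u` -/

namespace Matrix
variable {n : Type*} [Fintype n] [DecidableEq n]

lemma PosSemidef.re_trace_cfc_sq_rpow_mul_le {ρ S : Matrix n n ℂ} (hρ : ρ.PosSemidef)
    (hS : S.IsHermitian) {α : ℝ} (hα0 : 0 < α) (hα1 : α < 1) :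
    (cfc (fun s : ℝ => (s ^ 2) ^ α) S * cfc (fun t : ℝ => t ^ α) ρ).trace.re ≤
      (cfc (fun t : ℝ => t ^ α) (S * ρ * S)).trace.re := by
  rw [hS.re_trace_cfc_mul_cfc hρ.isHermitian]
  refine le_trans (le_of_eq ?_) (hρ.sum_overlap_rpow_le hS hα0 hα1)
  refine Finset.sum_congr rfl fun i _ => Finset.sum_congr rfl fun j _ => ?_
  rw [Real.mul_rpow (sq_nonneg _) (hρ.eigenvalues_nonneg j)]

/-- The inverse square root of `σ + u`. -/
noncomputable def shiftedInvSqrt (σ : Matrix n n ℂ) (u : ℝ) : Matrix n n ℂ :=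
  cfc (fun x : ℝ => (x + u) ^ (-(1 / 2) : ℝ)) σ

lemma isHermitian_shiftedInvSqrt (σ : Matrix n n ℂ) (u : ℝ) : (shiftedInvSqrt σ u).IsHermitian :=
  cfc_predicate (R := ℝ) (p := IsSelfAdjoint) _ σ

lemma PosSemidef.cfc_shiftedInvSqrt {σ : Matrix n n ℂ} (hσ : σ.PosSemidef) {u : ℝ} (hu : 0 < u)
    (α : ℝ) :
    cfc (fun s : ℝ => (s ^ 2) ^ α) (shiftedInvSqrt σ u) = cfc (fun x : ℝ => (x + u) ^ (-α)) σ := by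
  rw [shiftedInvSqrt, ← cfc_comp' _ _ σ ((σ.finite_real_spectrum.image _).continuousOn _)
    (σ.continuousOn_spectrum _) hσ.isHermitian.isSelfAdjoint]
  refine hσ.isHermitian.cfc_congr_eigenvalues fun i => ?_
  have : 0 ≤ hσ.isHermitian.eigenvalues i + u := add_nonneg (hσ.eigenvalues_nonneg i) hu.le
  rw [← Real.rpow_natCast, ← Real.rpow_mul this, ← Real.rpow_mul this]
  congr 1
  push_cast
  ring

lemma PosSemidef.shiftedInvSqrt_conj {σ : Matrix n n ℂ} (hσ : σ.PosSemidef) {u : ℝ} (hu : 0 < u) :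
    shiftedInvSqrt σ u * (σ + u • 1) * shiftedInvSqrt σ u = 1 := by
  have h1 : σ + u • 1 = cfc (fun x : ℝ => x + u) σ := by
    rw [cfc_add_const u (fun x : ℝ => x) σ (σ.continuousOn_spectrum _)
      hσ.isHermitian.isSelfAdjoint, cfc_id' ℝ σ hσ.isHermitian.isSelfAdjoint,
      Algebra.algebraMap_eq_smul_one]
  rw [h1, shiftedInvSqrt, cfc_mul_cfc, cfc_mul_cfc, ← one_smul ℝ (1 : Matrix n n ℂ),
    hσ.isHermitian.smul_one_eq_cfc]
  refine hσ.isHermitian.cfc_congr_eigenvalues fun i => ?_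
  have : 0 < hσ.isHermitian.eigenvalues i + u := add_pos_of_nonneg_of_pos (hσ.eigenvalues_nonneg i) hu
  rw [mul_right_comm, ← Real.rpow_add this]
  norm_num
  rw [Real.rpow_neg_one, inv_mul_cancel₀ this.ne']

/-- Since `S(σ + u)S = 1`, the form of `SρS - γ` at `v` is that of `ρ - γσ - γu` at `S v`; the
inertia comparison applies with `T = S`. -/
lemma PosSemidef.eigCount_conj_shiftedInvSqrt_le {ρ σ : Matrix n n ℂ} (hρ : ρ.PosSemidef)
    (hσ : σ.PosSemidef) {γ u : ℝ} (hu : 0 < u) (h : (ρ - γ • σ).IsHermitian) :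
    (hρ.conj_isHermitian (isHermitian_shiftedInvSqrt σ u)).isHermitian.eigCount γ ≤
      h.eigCount (γ * u) := by
  set S := shiftedInvSqrt σ u with hSdef
  have hS : S.IsHermitian := isHermitian_shiftedInvSqrt σ u
  refine IsHermitian.eigCount_le_eigCount _ h γ (γ * u) S fun v hv => ?_
  have h1 : S * ρ * S - γ • (1 : Matrix n n ℂ) = S * ((ρ - γ • σ - (γ * u) • 1) * S) := by
    have h2 : S * ((ρ - γ • σ - (γ * u) • 1) * S) =
        S * ρ * S - γ • (S * (σ + u • (1 : Matrix n n ℂ)) * S) := by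
      simp only [Matrix.mul_sub, Matrix.sub_mul, Matrix.mul_add, Matrix.add_mul, smul_add,
        Matrix.mul_smul, Matrix.smul_mul, smul_smul, Matrix.mul_one, Matrix.one_mul,
        Matrix.mul_assoc]
      abel
    rw [h2, hσ.shiftedInvSqrt_conj hu]
  rw [h1, ← mulVec_mulVec, ← mulVec_mulVec, dotProduct_mulVec] at hv
  rwa [star_mulVec, hS.eq]

end Matrix

/-! ### Hockey-stick divergence and the Petz trace -/

section HockeyStick

open Matrix

lemma isHermitian_sub_smul {n : Type*} {ρ σ : Matrix n n ℂ} (hρ : ρ.PosSemidef) (hσ : σ.PosSemidef) (γ : ℝ) :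
    (ρ - γ • σ).IsHermitian :=
  hρ.isHermitian.sub (hσ.isHermitian.smul (IsSelfAdjoint.all γ))

variable {n : Type*} [Fintype n] [DecidableEq n] {ρ σ : Matrix n n ℂ}

lemma eigCount_sub_smul_le (hρ : ρ.PosSemidef) (hσ : σ.PosSemidef) {γ : ℝ} (hγ : 0 ≤ γ) (c : ℝ) :
    (isHermitian_sub_smul hρ hσ γ).eigCount c ≤ hρ.isHermitian.eigCount c := by
  refine IsHermitian.eigCount_le_of_posSemidef_sub _ _ ?_ c
  rw [sub_sub_cancel]
  exact hσ.smul hγ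

lemma re_trace_matrixPosPart (hρ : ρ.PosSemidef) : (matrixPosPart ρ).trace.re = ρ.trace.re := by
  rw [matrixPosPart, hρ.isHermitian.cfc_congr_eigenvalues (g := fun x => x)
    fun i => max_eq_left (hρ.eigenvalues_nonneg i), cfc_id' ℝ ρ hρ.isHermitian.isSelfAdjoint]

lemma measurable_eigCount_sub_smul_mul (hρ : ρ.PosSemidef) (hσ : σ.PosSemidef) :
    Measurable fun p : ℝ × ℝ => (isHermitian_sub_smul hρ hσ p.1).eigCount (p.1 * p.2) :=
  (IsHermitian.measurable_eigCount_sub_smul hσ (isHermitian_sub_smul hρ hσ)).comp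
    (measurable_fst.prodMk (measurable_fst.mul measurable_snd))

lemma hockeyStick_nonneg (hρ : ρ.PosSemidef) (hσ : σ.PosSemidef) (γ : ℝ) :
    0 ≤ hockeyStick γ ρ σ := by
  rw [hockeyStick, matrixPosPart, (isHermitian_sub_smul hρ hσ γ).re_trace_cfc]
  exact Finset.sum_nonneg fun i _ => le_max_right _ _

lemma lintegral_eigCount_sub_smul (hρ : ρ.PosSemidef) (hσ : σ.PosSemidef) {γ : ℝ} (hγ : 0 < γ) :
    ENNReal.ofReal γ * ∫⁻ u in Set.Ioi (0 : ℝ),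
      ((isHermitian_sub_smul hρ hσ γ).eigCount (γ * u) : ℝ≥0∞) =
        ENNReal.ofReal (hockeyStick γ ρ σ) := by
  rw [IsHermitian.lintegral_eigCount_mul _ hγ, ← ENNReal.ofReal_mul hγ.le, mul_div_cancel₀ _ hγ.ne']
  rfl

lemma exists_measurable_eq_hockeyStick (hρ : ρ.PosSemidef) (hσ : σ.PosSemidef) :
    ∃ g : ℝ → ℝ, Measurable g ∧ ∀ γ, 0 < γ → hockeyStick γ ρ σ = g γ := by
  have h1 : Measurable fun γ : ℝ => (ENNReal.ofReal γ * ∫⁻ u in Set.Ioi (0 : ℝ),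
      ((isHermitian_sub_smul hρ hσ γ).eigCount (γ * u) : ℝ≥0∞)).toReal := by
    have : Measurable fun p : ℝ × ℝ =>
        ((isHermitian_sub_smul hρ hσ p.1).eigCount (p.1 * p.2) : ℝ≥0∞) :=
      measurable_from_nat.comp (measurable_eigCount_sub_smul_mul hρ hσ)
    exact (ENNReal.measurable_ofReal.mul this.lintegral_prod_right').ennreal_toReal
  refine ⟨_, h1, fun γ hγ => ?_⟩
  rw [lintegral_eigCount_sub_smul hρ hσ hγ, ENNReal.toReal_ofReal (hockeyStick_nonneg hρ hσ γ)]

/-- The layer-cake formula for `Tr ρ - Tr (ρ - γ σ)₊`. -/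
lemma lintegral_eigCount_sub_eigCount (hρ : ρ.PosSemidef) (hσ : σ.PosSemidef) {γ : ℝ}
    (hγ : 0 < γ) :
    ENNReal.ofReal γ * ∫⁻ u in Set.Ioi (0 : ℝ), ((hρ.isHermitian.eigCount (γ * u) -
      (isHermitian_sub_smul hρ hσ γ).eigCount (γ * u) : ℕ) : ℝ≥0∞) =
        ENNReal.ofReal (ρ.trace.re - hockeyStick γ ρ σ) := by
  have h1 : ENNReal.ofReal γ * ∫⁻ u in Set.Ioi (0 : ℝ), (hρ.isHermitian.eigCount (γ * u) : ℝ≥0∞) =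
      ENNReal.ofReal ρ.trace.re := by
    rw [IsHermitian.lintegral_eigCount_mul _ hγ, ← ENNReal.ofReal_mul hγ.le,
      mul_div_cancel₀ _ hγ.ne', re_trace_matrixPosPart hρ]
  -- The truncated subtraction of counts loses nothing, because `ρ - γσ ≤ ρ`.
  have h2 : ∀ u, (hρ.isHermitian.eigCount (γ * u) : ℝ≥0∞) = ((hρ.isHermitian.eigCount (γ * u) -
      (isHermitian_sub_smul hρ hσ γ).eigCount (γ * u) : ℕ) : ℝ≥0∞) +
      ((isHermitian_sub_smul hρ hσ γ).eigCount (γ * u) : ℝ≥0∞) := fun u => by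
    rw [← Nat.cast_add, Nat.sub_add_cancel (eigCount_sub_smul_le hρ hσ hγ.le _)]
  simp_rw [h2] at h1
  have hm : Measurable fun u : ℝ => ((isHermitian_sub_smul hρ hσ γ).eigCount (γ * u) : ℝ≥0∞) :=
    measurable_from_nat.comp ((IsHermitian.measurable_eigCount _).comp (measurable_const_mul γ))
  rw [lintegral_add_right _ hm, mul_add,
    lintegral_eigCount_sub_smul hρ hσ hγ] at h1
  rw [ENNReal.ofReal_sub _ (hockeyStick_nonneg hρ hσ γ), ← h1,
    ENNReal.add_sub_cancel_right ENNReal.ofReal_ne_top]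

lemma hockeyStick_le (hρ : ρ.PosSemidef) (hσ : σ.PosSemidef) {γ : ℝ} (hγ : 0 < γ) :
    hockeyStick γ ρ σ ≤ ρ.trace.re := by
  have h0 : 0 ≤ ρ.trace.re := by
    rw [← re_trace_matrixPosPart hρ]
    simpa [hockeyStick] using hockeyStick_nonneg hρ hσ 0
  rw [← ENNReal.ofReal_le_ofReal_iff h0, ← lintegral_eigCount_sub_smul hρ hσ hγ,
    ← re_trace_matrixPosPart hρ]
  have := hρ.isHermitian.lintegral_eigCount_mul hγ
  rw [← mul_div_cancel₀ (matrixPosPart ρ).trace.re hγ.ne', ENNReal.ofReal_mul hγ.le, ← this]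
  gcongr
  exact eigCount_sub_smul_le hρ hσ hγ.le _

/-- The core estimate at fixed `u`: inertia replaces the pencil by `SρS`, whose count integrates to
`Tr (SρS)^α`, and Araki–Lieb–Thirring separates `ρ` from `σ`. -/
lemma lintegral_rpow_mul_eigCount_sub_le (hρ : ρ.PosSemidef) (hσ : σ.PosSemidef) {α u : ℝ}
    (hα0 : 0 < α) (hα1 : α < 1) (hu : 0 < u) :
    ∫⁻ γ in Set.Ioi (0 : ℝ), ENNReal.ofReal (α * γ ^ (α - 1)) *
      ((hρ.isHermitian.eigCount (γ * u) -
        (isHermitian_sub_smul hρ hσ γ).eigCount (γ * u) : ℕ) : ℝ≥0∞) ≤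
      ENNReal.ofReal (∑ i, ∑ j, hσ.isHermitian.overlap hρ.isHermitian i j *
        ((u ^ (-α) - (hσ.isHermitian.eigenvalues i + u) ^ (-α)) *
          hρ.isHermitian.eigenvalues j ^ α)) := by
  have hS := isHermitian_shiftedInvSqrt σ u
  have hX := hρ.conj_isHermitian hS
  set S := shiftedInvSqrt σ u with hSdef
  have h1 := IsHermitian.lintegral_rpow_mul_eigCount hX hα0 one_pos
  have h2 := IsHermitian.lintegral_rpow_mul_eigCount hρ hα0 hu
  simp only [mul_one, Real.one_rpow, one_mul] at h1
  have halt := hρ.re_trace_cfc_sq_rpow_mul_le hS hα0 hα1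
  rw [hSdef, hσ.cfc_shiftedInvSqrt hu, ← hSdef] at halt
  have hsum : ∑ i, ∑ j, hσ.isHermitian.overlap hρ.isHermitian i j *
        ((u ^ (-α) - (hσ.isHermitian.eigenvalues i + u) ^ (-α)) *
          hρ.isHermitian.eigenvalues j ^ α) =
      u ^ (-α) * (cfc (fun x : ℝ => x ^ α) ρ).trace.re -
        (cfc (fun x : ℝ => (x + u) ^ (-α)) σ * cfc (fun t : ℝ => t ^ α) ρ).trace.re := by
    rw [hσ.isHermitian.re_trace_cfc_mul_cfc hρ.isHermitian, hρ.isHermitian.re_trace_cfc,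
      Finset.mul_sum]
    simp only [sub_mul, mul_sub, Finset.sum_sub_distrib]
    congr 1
    rw [Finset.sum_comm]
    refine Finset.sum_congr rfl fun j _ => ?_
    rw [← Finset.sum_mul, IsHermitian.sum_overlap_left, one_mul]
  rw [hsum]
  refine le_trans ?_ (ENNReal.ofReal_le_ofReal (sub_le_sub_left halt _))
  rw [ENNReal.ofReal_sub, ← h1, ← h2]
  swap
  · rw [hX.isHermitian.re_trace_cfc]
    exact Finset.sum_nonneg fun i _ => Real.rpow_nonneg (hX.eigenvalues_nonneg i) _
  -- Moving the `SρS` term to the left leaves a pointwise inequality between natural-number counts.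
  refine ENNReal.le_sub_of_add_le_right (by rw [h1]; exact ENNReal.ofReal_ne_top) ?_
  have hm : Measurable fun γ : ℝ => (hX.isHermitian.eigCount γ : ℝ≥0∞) :=
    measurable_from_nat.comp hX.isHermitian.measurable_eigCount
  rw [← lintegral_add_right _ (by fun_prop)]
  refine setLIntegral_mono' measurableSet_Ioi fun γ hγ => ?_
  rw [← mul_add, ← Nat.cast_add]
  gcongr
  have h3 : hX.isHermitian.eigCount γ ≤ (isHermitian_sub_smul hρ hσ γ).eigCount (γ * u) :=
    hρ.eigCount_conj_shiftedInvSqrt_le hσ hu (isHermitian_sub_smul hρ hσ γ)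
  have h4 := eigCount_sub_smul_le hρ hσ (le_of_lt hγ) (γ * u)
  omega

/-- The integral form of the comparison between `Tr ρ - Tr (ρ - γ σ)₊` and the Petz quantity. -/
lemma lintegral_rpow_mul_one_sub_hockeyStick_le (hρ : ρ.PosSemidef) (hσ : σ.PosSemidef) {α : ℝ}
    (hα0 : 0 < α) (hα1 : α < 1) :
    ∫⁻ γ in Set.Ioi (0 : ℝ), ENNReal.ofReal (α * γ ^ (α - 2) * (ρ.trace.re - hockeyStick γ ρ σ)) ≤
      ENNReal.ofReal (petzTrace α ρ σ / (1 - α)) := by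
  set D : ℝ × ℝ → ℝ≥0∞ := fun p => ((hρ.isHermitian.eigCount (p.1 * p.2) -
      (isHermitian_sub_smul hρ hσ p.1).eigCount (p.1 * p.2) : ℕ) : ℝ≥0∞) with hD
  have hDm : Measurable D := measurable_from_nat.comp
    ((hρ.isHermitian.measurable_eigCount.comp (measurable_fst.mul measurable_snd)).sub
      (measurable_eigCount_sub_smul_mul hρ hσ))
  have h1 : ∫⁻ γ in Set.Ioi (0 : ℝ),
      ENNReal.ofReal (α * γ ^ (α - 2) * (ρ.trace.re - hockeyStick γ ρ σ)) =
      ∫⁻ γ in Set.Ioi (0 : ℝ), ∫⁻ u in Set.Ioi (0 : ℝ),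
        ENNReal.ofReal (α * γ ^ (α - 1)) * D (γ, u) := by
    refine setLIntegral_congr_fun measurableSet_Ioi fun γ hγ => ?_
    have hγ' : (0 : ℝ) < γ := hγ
    have e : α * γ ^ (α - 1) = α * γ ^ (α - 2) * γ := by
      nth_rw 3 [← Real.rpow_one γ]
      rw [mul_assoc, ← Real.rpow_add hγ']
      ring_nf
    have e0 : 0 ≤ α * γ ^ (α - 2) := by positivity
    rw [lintegral_const_mul _ (by fun_prop), e, ENNReal.ofReal_mul e0,
      ENNReal.ofReal_mul e0, mul_assoc, ← lintegral_eigCount_sub_eigCount hρ hσ hγ']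
  have hs : ∀ i, 0 ≤ hσ.isHermitian.eigenvalues i := hσ.eigenvalues_nonneg
  have hp : ∀ j, 0 ≤ hρ.isHermitian.eigenvalues j := hρ.eigenvalues_nonneg
  have hw : ∀ i j, 0 ≤ hσ.isHermitian.overlap hρ.isHermitian i j :=
    IsHermitian.overlap_nonneg _ _
  rw [h1, lintegral_lintegral_swap (by
    refine Measurable.aemeasurable (Measurable.mul ?_ hDm)
    fun_prop)]
  calc _ ≤ ∫⁻ u in Set.Ioi (0 : ℝ), ∑ i, ∑ j,
          ENNReal.ofReal (hσ.isHermitian.overlap hρ.isHermitian i j *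
            hρ.isHermitian.eigenvalues j ^ α) *
          ENNReal.ofReal (u ^ (-α) - (hσ.isHermitian.eigenvalues i + u) ^ (-α)) := by
        refine setLIntegral_mono' measurableSet_Ioi fun u hu => ?_
        have hu' : (0 : ℝ) < u := hu
        have hd : ∀ i, 0 ≤ u ^ (-α) - (hσ.isHermitian.eigenvalues i + u) ^ (-α) := fun i =>
          sub_nonneg.mpr (Real.rpow_le_rpow_of_nonpos hu' (by linarith [hs i]) (by linarith))
        refine (lintegral_rpow_mul_eigCount_sub_le hρ hσ hα0 hα1 hu).trans (le_of_eq ?_)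
        have hnn : ∀ i j, 0 ≤ hσ.isHermitian.overlap hρ.isHermitian i j *
          ((u ^ (-α) - (hσ.isHermitian.eigenvalues i + u) ^ (-α)) *
            hρ.isHermitian.eigenvalues j ^ α) := fun i j =>
          mul_nonneg (hw i j) (mul_nonneg (hd i) (Real.rpow_nonneg (hp j) _))
        rw [ENNReal.ofReal_sum_of_nonneg fun i _ => Finset.sum_nonneg fun j _ => hnn i j]
        refine Finset.sum_congr rfl fun i _ => ?_
        rw [ENNReal.ofReal_sum_of_nonneg fun j _ => hnn i j]
        refine Finset.sum_congr rfl fun j _ => ?_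
        rw [← ENNReal.ofReal_mul (mul_nonneg (hw i j) (Real.rpow_nonneg (hp j) _))]
        congr 1
        ring
    _ = ∑ i, ∑ j, ENNReal.ofReal (hσ.isHermitian.overlap hρ.isHermitian i j *
            hρ.isHermitian.eigenvalues j ^ α) *
          ENNReal.ofReal (hσ.isHermitian.eigenvalues i ^ (1 - α) / (1 - α)) := by
        rw [lintegral_finsetSum _ fun i _ => by fun_prop]
        refine Finset.sum_congr rfl fun i _ => ?_
        rw [lintegral_finsetSum _ fun j _ => by fun_prop]
        refine Finset.sum_congr rfl fun j _ => ?_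
        rw [lintegral_const_mul _ (by fun_prop), lintegral_Ioi_rpow_neg_sub hα0 hα1 (hs i)]
    _ = ENNReal.ofReal (petzTrace α ρ σ / (1 - α)) := by
        have hnn : ∀ i j, 0 ≤ hσ.isHermitian.overlap hρ.isHermitian i j *
            hρ.isHermitian.eigenvalues j ^ α *
              (hσ.isHermitian.eigenvalues i ^ (1 - α) / (1 - α)) := fun i j =>
          mul_nonneg (mul_nonneg (hw i j) (Real.rpow_nonneg (hp j) _))
            (div_nonneg (Real.rpow_nonneg (hs i) _) (by linarith))
        rw [petzTrace, trace_mul_comm, matrixRpow, matrixRpow,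
          hσ.isHermitian.re_trace_cfc_mul_cfc hρ.isHermitian, Finset.sum_div,
          ENNReal.ofReal_sum_of_nonneg]
        · refine Finset.sum_congr rfl fun i _ => ?_
          rw [Finset.sum_div, ENNReal.ofReal_sum_of_nonneg]
          · refine Finset.sum_congr rfl fun j _ => ?_
            rw [← ENNReal.ofReal_mul (mul_nonneg (hw i j) (Real.rpow_nonneg (hp j) _))]
            congr 1
            ring
          · intro j _
            exact (hnn i j).trans_eq (by ring)
        · intro i _
          rw [Finset.sum_div]
          refine Finset.sum_nonneg fun j _ => ?_
          exact (hnn i j).trans_eq (by ring)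

end HockeyStick

/-! ### Hellinger divergence as a complement of `J` -/

section Hellinger

lemma deriv_deriv_hellinger {α x : ℝ} (hα1 : α < 1) (hx : 0 < x) :
    deriv (deriv fun x : ℝ => (x ^ α - 1) / (α - 1)) x = α * x ^ (α - 2) := by
  have hα : α - 1 ≠ 0 := by linarith
  have h1 : deriv (fun x : ℝ => (x ^ α - 1) / (α - 1)) =ᶠ[nhds x]
      fun x => α * x ^ (α - 1) / (α - 1) := by
    filter_upwards [lt_mem_nhds hx] with y hy
    exact (((Real.hasDerivAt_rpow_const (Or.inl hy.ne')).sub_const 1).div_const (α - 1)).deriv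
  rw [h1.deriv_eq, (((Real.hasDerivAt_rpow_const (p := α - 1) (Or.inl hx.ne')).const_mul
    α).div_const (α - 1)).deriv, show α - 1 - 1 = α - 2 by ring]
  field_simp

lemma lintegral_Ioi_one_rpow {α : ℝ} (hα0 : 0 < α) (hα1 : α < 1) :
    ∫⁻ γ in Set.Ioi (1 : ℝ), ENNReal.ofReal (α * γ ^ (α - 2) + α * γ ^ (-α - 1)) =
      ENNReal.ofReal (1 / (1 - α)) := by
  have h1 : IntegrableOn (fun γ : ℝ => α * γ ^ (α - 2)) (Set.Ioi 1) :=
    (integrableOn_Ioi_rpow_of_lt (by linarith) one_pos).const_mul α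
  have h2 : IntegrableOn (fun γ : ℝ => α * γ ^ (-α - 1)) (Set.Ioi 1) :=
    (integrableOn_Ioi_rpow_of_lt (by linarith) one_pos).const_mul α
  rw [← ofReal_integral_eq_lintegral_ofReal (f := fun γ : ℝ => α * γ ^ (α - 2) + α * γ ^ (-α - 1))
    (h1.add h2), integral_add h1 h2, integral_const_mul,
    integral_const_mul, integral_Ioi_rpow_of_lt (by linarith) one_pos,
    integral_Ioi_rpow_of_lt (by linarith) one_pos]
  · congr 1
    have h3 : 1 - α ≠ 0 := by linarith
    have h4 : α - 2 + 1 ≠ 0 := by linarith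
    have h5 : -α - 1 + 1 ≠ 0 := by linarith
    simp only [Real.one_rpow]
    field_simp
    ring
  · filter_upwards [self_mem_ae_restrict measurableSet_Ioi] with γ hγ
    have : (0 : ℝ) < γ := one_pos.trans hγ
    show 0 ≤ α * γ ^ (α - 2) + α * γ ^ (-α - 1)
    positivity

lemma lintegral_Ioi_one_comp_inv (F : ℝ → ℝ≥0∞) :
    ∫⁻ γ in Set.Ioi (1 : ℝ), ENNReal.ofReal ((γ ^ 2)⁻¹) * F γ⁻¹ = ∫⁻ t in Set.Ioo (0 : ℝ) 1, F t := by
  have him : (fun x : ℝ => x⁻¹) '' Set.Ioi 1 = Set.Ioo 0 1 := by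
    rw [Set.image_inv_eq_inv, Set.inv_Ioi₀ one_pos, inv_one]
  rw [← him, lintegral_image_eq_lintegral_abs_deriv_mul measurableSet_Ioi
    (fun x hx => (hasDerivAt_inv (one_pos.trans hx).ne').hasDerivWithinAt) inv_injective.injOn]
  refine setLIntegral_congr_fun measurableSet_Ioi fun γ _ => ?_
  simp only [abs_neg, abs_of_nonneg (inv_nonneg.mpr (sq_nonneg γ))]

variable {n : Type*} [Fintype n] [DecidableEq n] {ρ σ : Matrix n n ℂ}

open Matrix

/-- From `σ - γρ = -γ(ρ - γ⁻¹σ)` and `max (-γx) 0 = γ (max x 0 - x)` on eigenvalues. -/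
lemma hockeyStick_swap (hρ : ρ.PosSemidef) (hσ : σ.PosSemidef) {γ : ℝ} (hγ : 0 < γ) :
    hockeyStick γ σ ρ =
      σ.trace.re - γ * (ρ.trace.re - hockeyStick γ⁻¹ ρ σ) := by
  have hA := isHermitian_sub_smul hρ hσ γ⁻¹
  have h1 : σ - γ • ρ = (-γ) • (ρ - γ⁻¹ • σ) := by
    rw [smul_sub, smul_smul, neg_mul, mul_inv_cancel₀ hγ.ne']
    simp only [neg_smul, one_smul]
    abel
  have h2 : (-γ) • (ρ - γ⁻¹ • σ) = cfc (fun x : ℝ => (-γ) * x) (ρ - γ⁻¹ • σ) := by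
    rw [cfc_const_mul (-γ) (fun x : ℝ => x) _ (continuousOn_spectrum _ _),
      cfc_id' ℝ _ hA.isSelfAdjoint]
  have h3 : (ρ - γ⁻¹ • σ).trace.re = ∑ i, hA.eigenvalues i := by
    rw [← hA.re_trace_cfc (fun x => x), cfc_id' ℝ _ hA.isSelfAdjoint]
  have h4 : (ρ - γ⁻¹ • σ).trace.re = ρ.trace.re - γ⁻¹ * σ.trace.re := by
    rw [trace_sub, trace_smul, Complex.sub_re, Complex.real_smul, Complex.re_ofReal_mul]
  have h5 : hockeyStick γ σ ρ = γ * (hockeyStick γ⁻¹ ρ σ - (ρ - γ⁻¹ • σ).trace.re) := by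
    rw [hockeyStick, hockeyStick, h1, matrixPosPart, matrixPosPart, h2,
      ← cfc_comp' (fun x : ℝ => max x 0) (fun x : ℝ => -γ * x) (ρ - γ⁻¹ • σ)
        ((Set.Finite.image _ (Matrix.finite_real_spectrum)).continuousOn _) (continuousOn_spectrum _ _)
        hA.isSelfAdjoint, hA.re_trace_cfc, hA.re_trace_cfc, h3, ← Finset.sum_sub_distrib,
      Finset.mul_sum]
    refine Finset.sum_congr rfl fun i _ => ?_
    rcases le_total (hA.eigenvalues i) 0 with h | h
    · rw [max_eq_right h, max_eq_left (by nlinarith)]; ring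
    · rw [max_eq_left h, max_eq_right (by nlinarith)]; ring
  rw [h5, h4]
  field_simp
  ring

/-- The Hellinger divergence in terms of `1 - E_γ(ρ‖σ)`. -/
lemma hellingerDivergence_add_lintegral (hρ : IsQuantumState ρ) (hσ : IsQuantumState σ) {α : ℝ}
    (hα0 : 0 < α) (hα1 : α < 1) :
    hellingerDivergence α ρ σ +
      ∫⁻ γ in Set.Ioi (0 : ℝ), ENNReal.ofReal (α * γ ^ (α - 2) * (1 - hockeyStick γ ρ σ)) =
        ENNReal.ofReal (1 / (1 - α)) := by
  have htρ : ρ.trace.re = 1 := by rw [hρ.trace_eq_one, Complex.one_re]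
  have htσ : σ.trace.re = 1 := by rw [hσ.trace_eq_one, Complex.one_re]
  have hm1 : ∀ γ, 0 < γ → 0 ≤ 1 - hockeyStick γ ρ σ := fun γ hγ => by
    have := hockeyStick_le hρ.posSemidef hσ.posSemidef hγ
    linarith
  set F : ℝ → ℝ≥0∞ := fun γ => ENNReal.ofReal (α * γ ^ (α - 2) * (1 - hockeyStick γ ρ σ)) with hF
  obtain ⟨g, hg, hge⟩ := exists_measurable_eq_hockeyStick hρ.posSemidef hσ.posSemidef
  have hFm : AEMeasurable F (volume.restrict (Set.Ioi 1)) := by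
    have : Measurable fun γ : ℝ => ENNReal.ofReal (α * γ ^ (α - 2) * (1 - g γ)) := by fun_prop
    refine this.aemeasurable.congr ?_
    filter_upwards [self_mem_ae_restrict measurableSet_Ioi] with γ hγ
    simp only [hF, hge γ (one_pos.trans hγ)]
  have hFi : AEMeasurable (fun γ : ℝ => ENNReal.ofReal ((γ ^ 2)⁻¹) * F γ⁻¹)
      (volume.restrict (Set.Ioi 1)) := by
    have : Measurable fun γ : ℝ => ENNReal.ofReal ((γ ^ 2)⁻¹) *
        ENNReal.ofReal (α * γ⁻¹ ^ (α - 2) * (1 - g γ⁻¹)) := by fun_prop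
    refine this.aemeasurable.congr ?_
    filter_upwards [self_mem_ae_restrict measurableSet_Ioi] with γ hγ
    simp only [hF, hge γ⁻¹ (inv_pos.mpr (one_pos.trans hγ))]
  have hFs : AEMeasurable (fun γ : ℝ => F γ + ENNReal.ofReal ((γ ^ 2)⁻¹) * F γ⁻¹)
      (volume.restrict (Set.Ioi 1)) := hFm.add hFi
  -- Folding `(0, 1)` onto `(1, ∞)` puts `J` on the domain of the divergence, so the identity can be
  -- checked pointwise.
  have hsplit : ∫⁻ γ in Set.Ioi (0 : ℝ), F γ =
      (∫⁻ γ in Set.Ioi (1 : ℝ), F γ) + ∫⁻ γ in Set.Ioi (1 : ℝ), ENNReal.ofReal ((γ ^ 2)⁻¹) * F γ⁻¹ := by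
    rw [lintegral_Ioi_one_comp_inv, Measure.restrict_congr_set Ioo_ae_eq_Ioc, add_comm,
      ← lintegral_union measurableSet_Ioi (Set.Ioc_disjoint_Ioi le_rfl),
      Set.Ioc_union_Ioi_eq_Ioi zero_le_one]
  rw [hsplit, ← lintegral_add_left' hFm, hellingerDivergence,
    fDivergence, ← lintegral_add_right' _ hFs, ← lintegral_Ioi_one_rpow hα0 hα1]
  refine setLIntegral_congr_fun measurableSet_Ioi fun γ hγ => ?_
  have hγ1 : (1 : ℝ) < γ := hγ
  have hγ0 : (0 : ℝ) < γ := one_pos.trans hγ1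
  have e1 : (γ ^ 3)⁻¹ * (α * γ⁻¹ ^ (α - 2)) = α * γ ^ (-α - 1) := by
    rw [Real.inv_rpow hγ0.le, ← Real.rpow_neg hγ0.le, ← Real.rpow_natCast, ← Real.rpow_neg hγ0.le,
      mul_left_comm, ← Real.rpow_add hγ0]
    congr 2
    push_cast
    ring
  have e2 : (γ ^ 2)⁻¹ * (α * γ⁻¹ ^ (α - 2)) = α * γ ^ (-α - 1) * γ := by
    rw [← e1]
    field_simp
  have p1 := hm1 γ hγ0
  have p2 := hm1 γ⁻¹ (inv_pos.mpr hγ0)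
  have p3 := hockeyStick_nonneg hρ.posSemidef hσ.posSemidef γ
  have p4 := hockeyStick_nonneg hσ.posSemidef hρ.posSemidef γ
  simp only [hF]
  -- After the swap, every hockey-stick term cancels and only the two pure powers of `γ` remain.
  rw [deriv_deriv_hellinger hα1 hγ0, deriv_deriv_hellinger hα1 (inv_pos.mpr hγ0), e1,
    ← ENNReal.ofReal_mul (by positivity), ← mul_assoc ((γ ^ 2)⁻¹), e2,
    ← ENNReal.ofReal_add (by positivity) (by positivity),
    ← ENNReal.ofReal_add (by positivity) (by positivity),
    hockeyStick_swap hρ.posSemidef hσ.posSemidef hγ0, htρ, htσ]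
  congr 1
  ring

end Hellinger

theorem mainTheorem3 {n : Type*} [Fintype n] [DecidableEq n]
    (ρ σ : Matrix n n ℂ) (hρ : IsQuantumState ρ) (hσ : IsQuantumState σ)
    (α : ℝ) (hα0 : 0 < α) (hα1 : α < 1) :
    hellingerDivergence α ρ σ ≤ ENNReal.ofReal (1 / (1 - α)) ∧
      (petzHellingerDivergence α ρ σ : EReal) ≤ (hellingerDivergence α ρ σ : EReal) ∧
      petzRenyiDivergence α ρ σ ≤ renyiDivergence α ρ σ := by
  have hα : 0 < 1 - α := by linarith
  have h1 := hellingerDivergence_add_lintegral hρ hσ hα0 hα1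
  have h2 := lintegral_rpow_mul_one_sub_hockeyStick_le hρ.posSemidef hσ.posSemidef hα0 hα1
  rw [hρ.trace_eq_one, Complex.one_re] at h2
  set J := ∫⁻ γ in Set.Ioi (0 : ℝ), ENNReal.ofReal (α * γ ^ (α - 2) * (1 - hockeyStick γ ρ σ))
  have hle : hellingerDivergence α ρ σ ≤ ENNReal.ofReal (1 / (1 - α)) := h1 ▸ le_self_add
  have hHtop : hellingerDivergence α ρ σ ≠ ∞ := ne_top_of_le_ne_top ENNReal.ofReal_ne_top hle
  have hJtop : J ≠ ∞ := ne_top_of_le_ne_top ENNReal.ofReal_ne_top h2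
  have hpetz : 0 ≤ petzTrace α ρ σ := by
    rw [petzTrace]
    exact (hρ.posSemidef.isHermitian.posSemidef_cfc fun i => Real.rpow_nonneg
      (hρ.posSemidef.eigenvalues_nonneg i) α).re_trace_mul_nonneg
      (hσ.posSemidef.isHermitian.posSemidef_cfc fun i => Real.rpow_nonneg
      (hσ.posSemidef.eigenvalues_nonneg i) (1 - α))
  lift J to NNReal using hJtop with j
  obtain ⟨h, hh⟩ : ∃ h : NNReal, hellingerDivergence α ρ σ = h := ⟨_, (ENNReal.coe_toNNReal hHtop).symm⟩
  rw [hh] at h1 hle ⊢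
  have h1' : (h : ℝ) + j = 1 / (1 - α) := by
    have := congrArg ENNReal.toReal h1
    rwa [ENNReal.toReal_ofReal (by positivity), ← ENNReal.coe_add, ENNReal.coe_toReal,
      NNReal.coe_add] at this
  have h2' : (j : ℝ) ≤ petzTrace α ρ σ / (1 - α) := by
    have := ENNReal.toReal_mono ENNReal.ofReal_ne_top h2
    rwa [ENNReal.toReal_ofReal (by positivity)] at this
  refine ⟨hle, ?_, ?_⟩
  · have : petzHellingerDivergence α ρ σ ≤ h := by
      rw [petzHellingerDivergence]
      rw [show 1 / (1 - α) * (1 - petzTrace α ρ σ) = 1 / (1 - α) - petzTrace α ρ σ / (1 - α) by ring]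
      linarith
    exact EReal.coe_le_coe_iff.mpr this
  -- The argument of the logarithm is `(1 - α) J`, at most the Petz trace; the negative factor `(α -
  -- 1)⁻¹` reverses the order, also when a logarithm is `-∞`.
  · have e : (1 : EReal) + ((α - 1 : ℝ) : EReal) * ((h : ℝ≥0∞) : EReal) =
        (((1 - α) * j : ℝ) : EReal) := by
      have : (1 - α) * j = 1 + (α - 1) * h := by
        have h3 : (j : ℝ) = 1 / (1 - α) - h := by linarith
        rw [h3, mul_sub, mul_one_div_cancel hα.ne']
        ring
      rw [this]
      norm_cast
    rw [petzRenyiDivergence, renyiDivergence, hh, e, EReal.toENNReal_of_ne_top (EReal.coe_ne_top _),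
      EReal.toReal_coe]
    have hlog : ENNReal.log (ENNReal.ofReal ((1 - α) * j)) ≤
        ENNReal.log (ENNReal.ofReal (petzTrace α ρ σ)) := by
      apply ENNReal.log_monotone
      apply ENNReal.ofReal_le_ofReal
      rw [le_div_iff₀ hα] at h2'
      linarith
    have hc : (((α - 1)⁻¹ : ℝ) : EReal) ≤ 0 := by
      exact_mod_cast inv_nonpos.mpr (by linarith : α - 1 ≤ 0)
    rw [mul_comm, mul_comm (((α - 1)⁻¹ : ℝ) : EReal)]
    exact EReal.mul_le_mul_of_nonpos_right hlog hc
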